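/- Let $G$ be a group (not necessarily finitely generated), and let $\mathcal H$ be a non-empty union of finitely many conjugacy classes of two-ended (i.e. infinite, virtually cyclic) subgroups of $G$, with $\mathcal H\neq\{G\}$. Then $\mathcal H$ is indecomposable in $G$ if and only if the double $D(G,\mathcal H)$ is one-ended. Here a $G$-tree is a simplicial tree with a simplicial action of $G$ without edge inversions. A group $G$ splits over a finite group relative to a set $\mathcal H$ of subgroups if there is a $G$-tree with finite edge stabilisers such that $G$ fixes no vertex and every element of $\mathcal H$ fixes some vertex; $\mathcal H$ is indecomposable in $G$ if $G$ does not split in this way. A group is one-ended if it is infinite and does not split over a finite group (relative to $\emptyset$). The double $D(G,\mathcal H)$ is the fundamental group of the graph of groups with two vertices, each with vertex group $G$, joined by one edge for each conjugacy class in $\mathcal H$, whose edge group is a representative $H$ of the class, included in both copies of $G$. Explicitly, if $H_0,\dots,H_n$ are representatives of the conjugacy classes in $\mathcal H$ and $g\mapsto g'$, $g\mapsto g''$ denote the inclusions of the two copies $G'$, $G''$ of $G$, then $$D(G,\mathcal H)=\bigl\langle G',\,G'',\,t_0,\dots,t_n \;\big|\; t_0=1,\ \ t_i h' t_i^{-1}=h''\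 (0\le i\le n,\ h\in H_i)\bigr\rangle .$$ -/

import Mathlib

universe u

namespace DoubleOfGroup

/-- A group is two-ended (equivalently, infinite and virtually cyclic) if it has an infinite cyclic
subgroup of finite index. -/
def IsTwoEnded (H : Type u) [Group H] : Prop :=
  ∃ a : H, ¬ IsOfFinOrder a ∧ (Subgroup.zpowers a).FiniteIndex

/-- `K` and `L` are conjugate subgroups of `G`. -/
def AreConj {G : Type u} [Group G] (K L : Subgroup G) : Prop :=
  ∃ g : G, L = K.map (MulAut.conj g).toMonoidHom

/-- `𝓗` is the union of finitely many conjugacy classes of subgroups of `G`. -/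
def IsFiniteUnionOfConjClasses {G : Type u} [Group G] (𝓗 : Set (Subgroup G)) : Prop :=
  ∃ F : Set (Subgroup G), F.Finite ∧ 𝓗 = {L | ∃ K ∈ F, AreConj K L}

/-- `S` contains exactly one representative of each conjugacy class of subgroups in `𝓗`. -/
def IsConjTransversal {G : Type u} [Group G] (S 𝓗 : Set (Subgroup G)) : Prop :=
  S ⊆ 𝓗 ∧ ∀ L ∈ 𝓗, ∃! K, K ∈ S ∧ AreConj K L

/-- `T` is a `G`-tree: a simplicial tree on which `G` acts by simplicial automorphisms and
without edge inversions. -/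
structure IsGTree (G : Type u) [Group G] {V : Type u} [MulAction G V] (T : SimpleGraph V) :
    Prop where
  isTree : T.IsTree
  smul_adj : ∀ (g : G) (x y : V), T.Adj x y → T.Adj (g • x) (g • y)
  no_inversion : ∀ (g : G) (x y : V), T.Adj x y → ¬ (g • x = y ∧ g • y = x)

/-- The stabiliser of the edge joining `x` and `y`. As there are no edge inversions, an element
that preserves the edge fixes both of its endpoints. -/
def edgeStabilizer (G : Type u) [Group G] {V : Type u} [MulAction G V] (x y : V) : Subgroup G :=
  MulAction.stabilizer G x ⊓ MulAction.stabilizer G y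

/-- A subgroup is elliptic if it lies in some vertex stabiliser. -/
def IsElliptic {G : Type u} [Group G] (K : Subgroup G) (V : Type u) [MulAction G V] : Prop :=
  ∃ v : V, K ≤ MulAction.stabilizer G v

/-- `G` splits (non-trivially) over a finite group relative to `𝓗`: there is a `G`-tree with finite
edge stabilisers, such that no vertex stabiliser is all of `G`, and such that every element of `𝓗`
is elliptic. (Passing to the subtree spanned by one orbit of vertices shows that trees in
higher universes give nothing more.) -/
def SplitsOverFiniteRel (G : Type u) [Group G] (𝓗 : Set (Subgroup G)) : Prop :=
  ∃ (V : Type u) (_ : MulAction G V) (T : SimpleGraph V),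
    IsGTree G T ∧
    (∀ x y : V, T.Adj x y → Finite (edgeStabilizer G x y)) ∧
    (∀ v : V, MulAction.stabilizer G v ≠ ⊤) ∧
    ∀ K ∈ 𝓗, IsElliptic K V

/-- `𝓗` is indecomposable in `G` if `G` does not split over any finite group relative to `𝓗`. -/
def IsIndecomposable {G : Type u} [Group G] (𝓗 : Set (Subgroup G)) : Prop :=
  ¬ SplitsOverFiniteRel G 𝓗

/-- A group is one-ended if it is infinite and does not split non-trivially over any
finite subgroup. -/
def IsOneEnded (G : Type u) [Group G] : Prop :=
  Infinite G ∧ ¬ SplitsOverFiniteRel G ∅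

section Double

variable {G : Type u} [Group G] (S : Set (Subgroup G))

/-- The free product of two copies of `G` and the free group on the set `S` of edges. -/
abbrev DoubleGenerators : Type u :=
  Monoid.Coprod (Monoid.Coprod G G) (FreeGroup S)

namespace DoubleGenerators

/-- The inclusion of the first copy of `G`. -/
def left : G →* DoubleGenerators S :=
  Monoid.Coprod.inl.comp Monoid.Coprod.inl

/-- The inclusion of the second copy of `G`. -/
def right : G →* DoubleGenerators S :=
  Monoid.Coprod.inl.comp Monoid.Coprod.inr

/-- The stable letter of an edge. -/
def letter (K : S) : DoubleGenerators S :=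
  Monoid.Coprod.inr (FreeGroup.of K)

end DoubleGenerators

open DoubleGenerators in
/-- The relations of the fundamental group of the graph of groups described at `Double`, with
respect to the maximal tree consisting of the single edge `K₀`: the letter of `K₀` is trivial, and
the letter of an edge `K` conjugates the copy of `k ∈ K` in the first vertex group to its copy in
the second vertex group. -/
def doubleRelations (K₀ : S) : Set (DoubleGenerators S) :=
  {letter S K₀} ∪
    {w | ∃ (K : S) (k : G), k ∈ (K : Subgroup G) ∧
      w = letter S K * left S k * (letter S K)⁻¹ * (right S k)⁻¹}

/-- The double: the fundamental group of the graph of groups with two vertices, both with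
vertex group `G`, and, for each `K ∈ S`, one edge with edge group `K` connecting the two vertices,
both edge maps being the inclusion `K → G`. It is given by its standard presentation with
respect to the maximal tree consisting of the edge `K₀`. To form the double of `G` in a union `𝓗`
of conjugacy classes of subgroups, `S` is a set of representatives of these classes. -/
abbrev Double (K₀ : S) : Type u :=
  DoubleGenerators S ⧸ Subgroup.normalClosure (doubleRelations S K₀)

end Double

end DoubleOfGroup

/-!
# One-endedness of doubles

Both directions rest on elementary arguments with half-trees; neither Stallings' theorem nor the
structure theory of hyperbolic isometries is needed.

*Gluing trees.* Let `p` assign to each member `K` of `S` a vertex of a `G`-tree fixed by `K`. The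
translates of two copies of the `G`-tree, glued along the vertices `p K`, form a graph on which
the double acts (`glueGraph`). Its edge stabilisers are conjugates of those of the `G`-tree, and
it retracts onto the `G`-tree. That it is a tree is the statement that every edge is a bridge.
This is certified by a potential with values in the functions on the formal edges, and such a
potential amounts to a crossed homomorphism on the double, which can be written down on the
generators (`exists_potential`). Two cases are used. If the `G`-tree is a splitting of `G`
relative to `𝓗`, the glued tree is a splitting of the double over finite groups. If it is the star
with leaves `G ⧸ K` for `K ∈ S`, the glued tree is the (subdivided) Bass-Serre tree of the double.

*Splittings of the double.* Conversely, let the double act on a tree with finite edge stabilisers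
and without a global fixed point, and suppose that `𝓗` is indecomposable. A subgroup crosses an
edge if infinitely many of its elements move a given vertex to either side (`Crosses`); for a
two-ended subgroup this means that the edge lies on its axis. If no member of `𝓗` crosses an edge,
all of them are elliptic, hence so are both copies of `G`. As the members of `𝓗` are infinite, the
fixed vertices of the two copies agree and are fixed by the stable letters, a contradiction.
Otherwise fix an edge that is crossed. Modulo the edge groups only finitely many translates of the
members of `S` cross it, so these form a finite non-empty set of edges of the Bass-Serre tree.
Some vertex of the Bass-Serre tree lies on exactly one of these edges (`exists_unique_edge`).
After a translation this says that for one of the two copies of `G` the edge is crossed by exactly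
one conjugate of exactly one member `K` of `S`. Hence the translates of this edge are partitioned
into the axes of the conjugates of `K`. Collapsing all other edges, and replacing each of these
axes by a cone, gives a splitting of `G` relative to `𝓗`
(`splitsOverFiniteRel_of_unique_crosses`), a contradiction. This new tree has no global fixed
point: collapsed components lie on one side of the edge and hence are moved by `K`, and if `G`
fixed a cone point, it would stabilise the axis of `K`, and uniqueness would give `𝓗 = {⊤}`.
-/

/-! ### Half-trees -/

namespace DoubleOfGroup

section Trees

variable {V : Type u} {T : SimpleGraph V}

/-- The half-tree of the oriented edge from `a` to `b` containing its origin `a`: the vertices that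
are closer to `a` than to `b`. -/
def half (T : SimpleGraph V) (a b : V) : Set V := {x | T.dist x a < T.dist x b}

lemma left_mem_half {a b : V} (hab : T.Adj a b) : a ∈ half T a b := by
  simp only [half, Set.mem_ofPred_eq, SimpleGraph.dist_self]
  exact hab.reachable.pos_dist_of_ne hab.ne

lemma right_notMem_half (a b : V) : b ∉ half T a b := by
  simp [half]

lemma notMem_half_iff (hT : T.IsTree) {a b x : V} (hab : T.Adj a b) :
    x ∉ half T a b ↔ x ∈ half T b a := by
  have := hT.dist_ne_of_adj x hab
  simp only [half, Set.mem_ofPred_eq]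
  omega

lemma exists_adj_dist_lt (hT : T.IsTree) {x a : V} (h : x ≠ a) :
    ∃ y, T.Adj x y ∧ T.dist x a = T.dist y a + 1 := by
  obtain ⟨p, hp⟩ := hT.connected.exists_walk_length_eq_dist x a
  cases p with
  | nil => exact absurd rfl h
  | @cons _ y _ hxy q =>
    refine ⟨y, hxy, ?_⟩
    have h1 := SimpleGraph.dist_le q
    have h2 := hT.dist_eq_dist_add_one_of_adj a hxy
    rw [SimpleGraph.dist_comm (u := a) (v := x), SimpleGraph.dist_comm (u := a) (v := y)] at h2
    rw [SimpleGraph.Walk.length_cons] at hp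
    omega

/-- Half-trees are connected, stated as an induction principle. -/
lemma half_induction (hT : T.IsTree) {a b : V} (P : V → Prop) (ha : P a)
    (step : ∀ x y, T.Adj x y → x ∈ half T a b → y ∈ half T a b → P x → P y) :
    ∀ x ∈ half T a b, P x := by
  intro x hx
  induction hn : T.dist x a using Nat.strong_induction_on generalizing x with
  | _ n ih =>
    by_cases hxa : x = a
    · exact hxa ▸ ha
    obtain ⟨y, hxy, hd⟩ := exists_adj_dist_lt hT hxa
    have hy : y ∈ half T a b := by
      have h2 := hxy.diff_dist_adj (u := b)
      rw [SimpleGraph.dist_comm (u := b) (v := x), SimpleGraph.dist_comm (u := b) (v := y)] at h2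
      simp only [half, Set.mem_ofPred_eq] at hx ⊢
      omega
    exact step y x hxy.symm hy hx (ih _ (by omega) y hy rfl)

/-- The only edge of a tree that leaves the half-tree of an edge is that edge itself. -/
lemma eq_of_mem_half_of_notMem_half (hT : T.IsTree) {a b x y : V} (hab : T.Adj a b)
    (hxy : T.Adj x y) (hx : x ∈ half T a b) (hy : y ∉ half T a b) : x = a ∧ y = b := by
  have key : ∀ {c d : V}, s(c, d) = s(a, b) → ∀ z ∈ half T c d,
      (T.deleteEdges {s(a, b)}).Reachable c z := by
    intro c d hcd
    refine half_induction hT _ (SimpleGraph.Reachable.refl _) ?_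
    intro z w hzw hz hw h
    refine h.trans (SimpleGraph.Adj.reachable ?_)
    rw [SimpleGraph.deleteEdges_adj]
    refine ⟨hzw, ?_⟩
    rw [Set.mem_singleton_iff, ← hcd]
    intro h'
    rcases Sym2.eq_iff.1 h' with ⟨-, rfl⟩ | ⟨rfl, -⟩
    · exact right_notMem_half _ _ hw
    · exact right_notMem_half _ _ hz
  have h1 := key rfl x hx
  have h2 := key Sym2.eq_swap y ((notMem_half_iff hT hab).1 hy)
  by_cases h : s(x, y) = s(a, b)
  · rcases Sym2.eq_iff.1 h with h | ⟨rfl, -⟩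
    · exact h
    · exact absurd hx (right_notMem_half _ _)
  · refine absurd ?_ (SimpleGraph.isBridge_iff.1
      (SimpleGraph.isAcyclic_iff_forall_adj_isBridge.1 hT.isAcyclic hab))
    refine (h1.trans (SimpleGraph.Adj.reachable ?_)).trans h2.symm
    rw [SimpleGraph.deleteEdges_adj]
    exact ⟨hxy, h⟩

lemma mem_half_iff_of_adj (hT : T.IsTree) {a b x y : V} (hab : T.Adj a b)
    (hxy : T.Adj x y) (hne : s(x, y) ≠ s(a, b)) : x ∈ half T a b ↔ y ∈ half T a b := by
  constructor
  · intro hx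
    by_contra hy
    obtain ⟨rfl, rfl⟩ := eq_of_mem_half_of_notMem_half hT hab hxy hx hy
    exact hne rfl
  · intro hy
    by_contra hx
    obtain ⟨rfl, rfl⟩ := eq_of_mem_half_of_notMem_half hT hab hxy.symm hy hx
    exact hne Sym2.eq_swap

/-- Half-trees are nested: if the edge from `c` to `d` lies in the half-tree of `a`, then the
half-tree of that edge which does not contain the edge from `a` to `b` lies in there as well. -/
lemma half_subset_half (hT : T.IsTree) {a b c d : V} (hab : T.Adj a b) (hcd : T.Adj c d)
    (hne : s(c, d) ≠ s(a, b)) (hc : c ∈ half T a b) (hb : b ∈ half T c d) :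
    half T d c ⊆ half T a b := by
  intro x hx
  by_contra hx'
  rw [notMem_half_iff hT hab] at hx'
  have : x ∈ half T c d := by
    refine half_induction hT (a := b) (b := a) (fun z => z ∈ half T c d) hb ?_ x hx'
    intro z w hzw hz hw h
    refine (mem_half_iff_of_adj hT hcd hzw ?_).1 h
    intro h'
    rcases Sym2.eq_iff.1 h' with ⟨rfl, rfl⟩ | ⟨rfl, rfl⟩
    · exact (notMem_half_iff hT hab).2 hz hc
    · exact (notMem_half_iff hT hab).2 hw hc
  exact (notMem_half_iff hT hcd).2 hx this

/-- A property that is constant along every edge separating `x` from `y` takes the same value at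
`x` and at `y`. -/
lemma iff_of_forall_separating (hT : T.IsTree) (F : V → Prop) (x y : V)
    (h : ∀ u v, T.Adj u v → x ∈ half T u v → y ∈ half T v u → (F u ↔ F v)) : F x ↔ F y := by
  induction hn : T.dist y x using Nat.strong_induction_on generalizing y with
  | _ n ih =>
    by_cases hyx : y = x
    · rw [hyx]
    obtain ⟨z, hyz, hd⟩ := exists_adj_dist_lt hT hyx
    rw [SimpleGraph.dist_comm (u := y), SimpleGraph.dist_comm (u := z)] at hd
    have hx : x ∈ half T z y := by simp only [half, Set.mem_ofPred_eq]; omega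
    rw [ih (T.dist z x) (by rw [SimpleGraph.dist_comm (u := z), ← hn,
      SimpleGraph.dist_comm (u := y)]; omega) z ?_ rfl]
    · exact h z y hyz.symm hx (left_mem_half hyz)
    · intro u v huv hxu hzv
      refine h u v huv hxu ?_
      by_contra hy
      obtain ⟨rfl, rfl⟩ := eq_of_mem_half_of_notMem_half hT huv.symm hyz.symm hzv hy
      exact (notMem_half_iff hT huv).2 hx hxu

lemma exists_separating (hT : T.IsTree) {x y : V} (h : x ≠ y) :
    ∃ u v, T.Adj u v ∧ x ∈ half T u v ∧ y ∈ half T v u := by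
  by_contra! h'
  refine h ((iff_of_forall_separating hT (fun z => x = z) x y ?_).1 rfl)
  intro u v huv hx hy
  exact absurd hy (h' u v huv hx)

/-- Only finitely many edges separate two vertices of a tree. -/
lemma finite_separating (hT : T.IsTree) (x y : V) :
    {e : V × V | T.Adj e.1 e.2 ∧ x ∈ half T e.1 e.2 ∧ y ∈ half T e.2 e.1}.Finite := by
  obtain ⟨p⟩ := hT.connected.preconnected x y
  induction p with
  | @nil x =>
    convert Set.finite_empty
    rw [Set.eq_empty_iff_forall_notMem]
    rintro ⟨a, b⟩ ⟨h, h1, h2⟩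
    exact (notMem_half_iff hT h).2 h2 h1
  | @cons x z y hxz p ih =>
    refine (ih.insert (x, z)).subset ?_
    rintro ⟨a, b⟩ ⟨h, h1, h2⟩
    by_cases hz : z ∈ half T a b
    · exact Or.inr ⟨h, hz, h2⟩
    · obtain ⟨rfl, rfl⟩ := eq_of_mem_half_of_notMem_half hT h hxz h1 hz
      exact Or.inl rfl

/-- Among two neighbours of a vertex of a tree, at most one is closer to a given vertex. -/
lemma eq_of_mem_half_of_mem_half (hT : T.IsTree) {m x y z : V} (hx : T.Adj x m) (hy : T.Adj y m)
    (hzx : z ∈ half T x m) (hzy : z ∈ half T y m) : x = y := by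
  by_contra hne
  have h1 : s(y, m) ≠ s(x, m) := by
    intro h
    rcases Sym2.eq_iff.1 h with ⟨rfl, -⟩ | ⟨rfl, rfl⟩ <;> exact hne rfl
  have h2 : y ∈ half T m x := by
    rw [← notMem_half_iff hT hx, mem_half_iff_of_adj hT hx hy h1]
    exact right_notMem_half _ _
  refine (notMem_half_iff hT hx).2 ?_ hzx
  refine half_induction hT (a := y) (b := m) (fun w => w ∈ half T m x) h2 ?_ z hzy
  intro u v huv hu hv h
  refine (mem_half_iff_of_adj hT hx.symm huv ?_).1 h
  intro h'
  rcases Sym2.eq_iff.1 h' with ⟨rfl, -⟩ | ⟨-, rfl⟩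
  · exact right_notMem_half _ _ hu
  · exact right_notMem_half _ _ hv

/-- A connected graph is a tree as soon as for every edge there is a function on the vertices whose
value changes along this edge, but along no other edge. -/
lemma isTree_of_forall_adj_exists (hT : T.Connected)
    (h : ∀ u v, T.Adj u v → ∃ (α : Type) (f : V → α), f u ≠ f v ∧
      ∀ x y, T.Adj x y → f x ≠ f y → s(x, y) = s(u, v)) : T.IsTree := by
  refine ⟨hT, SimpleGraph.isAcyclic_iff_forall_adj_isBridge.2 fun u v huv => ?_⟩
  rw [SimpleGraph.isBridge_iff]
  rintro ⟨p⟩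
  obtain ⟨α, f, hf, hf'⟩ := h u v huv
  have key : ∀ {x y : V}, (T.deleteEdges {s(u, v)}).Walk x y → f x = f y := by
    intro x y q
    induction q with
    | nil => rfl
    | cons hxz q ih =>
      rw [← ih]
      rw [SimpleGraph.deleteEdges_adj] at hxz
      by_contra hne
      exact hxz.2 (hf' _ _ hxz.1 hne)
  exact hf (key p)

end Trees

/-! ### Subgroups crossing an edge -/

section Deep

variable {G : Type u} [Group G] {V : Type u} [MulAction G V] {T : SimpleGraph V}

lemma IsGTree.dist_smul (hT : IsGTree G T) (g : G) (x y : V) :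
    T.dist (g • x) (g • y) = T.dist x y := by
  have key : ∀ (g : G) (x y : V), T.dist (g • x) (g • y) ≤ T.dist x y := by
    intro g x y
    obtain ⟨p, hp⟩ := hT.isTree.connected.exists_walk_length_eq_dist x y
    let f : T →g T := ⟨fun z => g • z, fun h => hT.smul_adj g _ _ h⟩
    rw [← hp, ← SimpleGraph.Walk.length_map f p]
    exact SimpleGraph.dist_le (p.map f)
  refine le_antisymm (key g x y) ?_
  simpa using key g⁻¹ (g • x) (g • y)

lemma IsGTree.smul_mem_half_iff (hT : IsGTree G T) (g : G) {a b x : V} :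
    g • x ∈ half T (g • a) (g • b) ↔ x ∈ half T a b := by
  simp [half, hT.dist_smul]

lemma IsGTree.mem_half_smul_iff (hT : IsGTree G T) (g : G) {a b x : V} :
    x ∈ half T (g • a) (g • b) ↔ g⁻¹ • x ∈ half T a b := by
  rw [← hT.smul_mem_half_iff g (x := g⁻¹ • x), smul_inv_smul]

lemma IsGTree.smul_eq_of_sym2_eq (hT : IsGTree G T) {g : G} {x y : V} (hxy : T.Adj x y)
    (h : s(g • x, g • y) = s(x, y)) : g • x = x ∧ g • y = y := by
  rcases Sym2.eq_iff.1 h with h | h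
  · exact h
  · exact absurd h (hT.no_inversion g x y hxy)

/-- An element fixing two distinct vertices fixes an edge, namely the first one on the geodesic. -/
lemma IsGTree.exists_le_edgeStabilizer (hT : IsGTree G T) {x y : V} (hxy : x ≠ y) :
    ∃ z, T.Adj x z ∧ edgeStabilizer G x y ≤ edgeStabilizer G x z := by
  obtain ⟨z, hxz, hd⟩ := exists_adj_dist_lt hT.isTree hxy
  refine ⟨z, hxz, fun g hg => ⟨hg.1, ?_⟩⟩
  have h1 : g • x = x := hg.1
  have h2 : g • y = y := hg.2
  have hz : y ∈ half T z x := by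
    simp only [half, Set.mem_ofPred_eq]
    rw [SimpleGraph.dist_comm (u := y), SimpleGraph.dist_comm (u := y)]
    omega
  have hgz : y ∈ half T (g • z) x := by
    have := (hT.smul_mem_half_iff g).2 hz
    rwa [h1, h2] at this
  refine eq_of_mem_half_of_mem_half hT.isTree (m := x) (z := y) ?_ hxz.symm hgz hz
  have := hT.smul_adj g _ _ hxz.symm
  rwa [h1] at this

variable (G T) in
/-- All edge stabilisers are finite. -/
def HasFiniteEdgeStabilizers : Prop :=
  ∀ x y : V, T.Adj x y → Finite (edgeStabilizer G x y)

lemma HasFiniteEdgeStabilizers.finite_transporter (hf : HasFiniteEdgeStabilizers G T) {x y : V}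
    (hxy : T.Adj x y) (a b : V) : {g : G | g • x = a ∧ g • y = b}.Finite := by
  rcases Set.eq_empty_or_nonempty {g : G | g • x = a ∧ g • y = b} with h | ⟨g, h1, h2⟩
  · rw [h]; exact Set.finite_empty
  have := hf x y hxy
  have hfin : ((edgeStabilizer G x y : Subgroup G) : Set G).Finite := Set.toFinite _
  refine (hfin.image (fun k => g * k)).subset ?_
  rintro k ⟨h3, h4⟩
  refine ⟨g⁻¹ * k, ⟨?_, ?_⟩, by simp⟩
  · change (g⁻¹ * k) • x = x
    rw [mul_smul, h3, ← h1, inv_smul_smul]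
  · change (g⁻¹ * k) • y = y
    rw [mul_smul, h4, ← h2, inv_smul_smul]

variable (T) in
/-- A subgroup `K` is deep in the half-tree of the oriented edge from `a` to `b` if infinitely many
of its elements move a given vertex into it. If edge stabilisers are finite this does not depend on
the vertex, see `isDeep_of_infinite`. -/
def IsDeep (K : Subgroup G) (a b : V) : Prop :=
  ∀ y, {k : G | k ∈ K ∧ k • y ∈ half T a b}.Infinite

variable (T) in
/-- A subgroup crosses an edge if it is deep in both of its half-trees. For a two-ended subgroup
this says that it acts hyperbolically and that its axis contains the edge. -/
def Crosses (K : Subgroup G) (a b : V) : Prop :=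
  IsDeep T K a b ∧ IsDeep T K b a

lemma Crosses.symm {K : Subgroup G} {a b : V} (h : Crosses T K a b) : Crosses T K b a :=
  ⟨h.2, h.1⟩

lemma isDeep_of_infinite (hT : IsGTree G T) (hf : HasFiniteEdgeStabilizers G T) {K : Subgroup G}
    {a b : V} (hab : T.Adj a b) {y : V} (h : {k : G | k ∈ K ∧ k • y ∈ half T a b}.Infinite) :
    IsDeep T K a b := by
  intro z
  obtain ⟨p⟩ := hT.isTree.connected.preconnected y z
  induction p with
  | nil => exact h
  | @cons y x z hyx p ih =>
    refine ih ?_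
    by_contra hx
    rw [Set.not_infinite] at hx
    refine h ((hx.union (hf.finite_transporter hyx a b)).subset ?_)
    rintro k ⟨hk, hky⟩
    by_cases hkx : k • x ∈ half T a b
    · exact Or.inl ⟨hk, hkx⟩
    · exact Or.inr (eq_of_mem_half_of_notMem_half hT.isTree hab (hT.smul_adj k _ _ hyx) hky hkx)

lemma IsDeep.mono {K L : Subgroup G} (hKL : K ≤ L) {a b : V} (h : IsDeep T K a b) :
    IsDeep T L a b :=
  fun y => (h y).mono fun _ hk => ⟨hKL hk.1, hk.2⟩

lemma IsDeep.mono_half {K : Subgroup G} {a b c d : V} (hs : half T a b ⊆ half T c d)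
    (h : IsDeep T K a b) : IsDeep T K c d :=
  fun y => (h y).mono fun _ hk => ⟨hk.1, hs hk.2⟩

/-- An infinite subgroup is deep in one of the half-trees of each edge. -/
lemma isDeep_or_isDeep (hT : IsGTree G T) (hf : HasFiniteEdgeStabilizers G T) {K : Subgroup G}
    (hK : (K : Set G).Infinite) {a b : V} (hab : T.Adj a b) :
    IsDeep T K a b ∨ IsDeep T K b a := by
  by_contra! h
  have h1 : {k : G | k ∈ K ∧ k • a ∈ half T a b}.Finite :=
    Set.not_infinite.1 fun h' => h.1 (isDeep_of_infinite hT hf hab h')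
  have h2 : {k : G | k ∈ K ∧ k • a ∈ half T b a}.Finite :=
    Set.not_infinite.1 fun h' => h.2 (isDeep_of_infinite hT hf hab.symm h')
  refine hK ((h1.union h2).subset fun k hk => ?_)
  by_cases hka : k • a ∈ half T a b
  · exact Or.inl ⟨hk, hka⟩
  · exact Or.inr ⟨hk, (notMem_half_iff hT.isTree hab).1 hka⟩

/-- Depth passes to subgroups `L` of finite index, in the form `K ⊆ L * R` with `R` finite. -/
lemma IsDeep.of_finite_cover (hT : IsGTree G T) (hf : HasFiniteEdgeStabilizers G T)
    {K L : Subgroup G} {R : Set G} (hR : R.Finite) (hc : ∀ k ∈ K, ∃ l ∈ L, ∃ r ∈ R, k = l * r)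
    {a b : V} (hab : T.Adj a b) (h : IsDeep T K a b) : IsDeep T L a b := by
  by_contra hL
  refine h a (Set.Finite.subset (hR.biUnion (t := fun r =>
    (fun l => l * r) '' {l : G | l ∈ L ∧ l • (r • a) ∈ half T a b}) fun r _ => ?_) ?_)
  · refine Set.Finite.image _ (Set.not_infinite.1 fun h' => hL (isDeep_of_infinite hT hf hab h'))
  · rintro k ⟨hk, hka⟩
    obtain ⟨l, hl, r, hr, rfl⟩ := hc k hk
    rw [Set.mem_iUnion₂]
    exact ⟨r, hr, l, ⟨hl, by rwa [← mul_smul]⟩, rfl⟩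

lemma isDeep_map_conj (hT : IsGTree G T) {K : Subgroup G} (g : G) {a b : V} :
    IsDeep T (K.map (MulAut.conj g).toMonoidHom) a b ↔ IsDeep T K (g⁻¹ • a) (g⁻¹ • b) := by
  have key : ∀ y, {k : G | k ∈ K.map (MulAut.conj g).toMonoidHom ∧ k • y ∈ half T a b} =
      (MulAut.conj g) '' {k : G | k ∈ K ∧ k • (g⁻¹ • y) ∈ half T (g⁻¹ • a) (g⁻¹ • b)} := by
    intro y
    ext k
    constructor
    · rintro ⟨⟨k, hk, rfl⟩, h⟩
      refine ⟨k, ⟨hk, ?_⟩, rfl⟩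
      rw [hT.mem_half_smul_iff]
      simpa [MulAut.conj_apply, mul_smul] using h
    · rintro ⟨k, ⟨hk, h⟩, rfl⟩
      refine ⟨⟨k, hk, rfl⟩, ?_⟩
      rw [hT.mem_half_smul_iff] at h
      simpa [MulAut.conj_apply, mul_smul] using h
  unfold IsDeep
  constructor
  · intro h y
    have := h (g • y)
    rw [key, inv_smul_smul, Set.infinite_image_iff (MulAut.conj g).injective.injOn] at this
    exact this
  · intro h y
    rw [key, Set.infinite_image_iff (MulAut.conj g).injective.injOn]
    exact h _

lemma crosses_map_conj (hT : IsGTree G T) {K : Subgroup G} (g : G) {a b : V} :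
    Crosses T (K.map (MulAut.conj g).toMonoidHom) a b ↔ Crosses T K (g⁻¹ • a) (g⁻¹ • b) :=
  and_congr (isDeep_map_conj hT g) (isDeep_map_conj hT g)

lemma isDeep_smul_of_mem (hT : IsGTree G T) {K : Subgroup G} {g : G} (hg : g ∈ K) {a b : V} :
    IsDeep T K (g • a) (g • b) ↔ IsDeep T K a b := by
  have h : K.map (MulAut.conj g).toMonoidHom = K := by
    ext k
    constructor
    · rintro ⟨k, hk, rfl⟩
      exact K.mul_mem (K.mul_mem hg hk) (K.inv_mem hg)
    · intro hk
      refine ⟨g⁻¹ * k * g, K.mul_mem (K.mul_mem (K.inv_mem hg) hk) hg, ?_⟩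
      simp [MulAut.conj_apply, mul_assoc]
  rw [← h, isDeep_map_conj hT, inv_smul_smul, inv_smul_smul, h]

/-- A half-tree containing an edge that is crossed by `K` is one in which `K` is deep. -/
lemma Crosses.isDeep (hT : IsGTree G T) {K : Subgroup G} {a b c d : V} (h : Crosses T K c d)
    (hab : T.Adj a b) (hcd : T.Adj c d) (hne : s(c, d) ≠ s(a, b)) (hc : c ∈ half T a b) :
    IsDeep T K a b := by
  by_cases hb : b ∈ half T c d
  · exact h.2.mono_half (half_subset_half hT.isTree hab hcd hne hc hb)
  · rw [notMem_half_iff hT.isTree hcd] at hb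
    refine h.1.mono_half (half_subset_half hT.isTree hab hcd.symm ?_ ?_ hb)
    · rwa [Sym2.eq_swap]
    · exact (mem_half_iff_of_adj hT.isTree hab hcd hne).1 hc

end Deep

/-! ### Two-ended groups acting on trees -/

section TwoEnded

variable {G : Type u} [Group G]

/-- The element `t` of `K` has infinite order and the cyclic subgroup it generates has finite index
in `K`, in the form that `K` is covered by finitely many of its cosets. -/
structure IsVirtuallyZPowers (K : Subgroup G) (t : G) : Prop where
  mem : t ∈ K
  not_isOfFinOrder : ¬ IsOfFinOrder t
  cover : ∃ R : Set G, R.Finite ∧ ∀ k ∈ K, ∃ n : ℤ, ∃ r ∈ R, k = t ^ n * r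

lemma IsTwoEnded.exists_isVirtuallyZPowers {K : Subgroup G} (hK : IsTwoEnded K) :
    ∃ t, IsVirtuallyZPowers K t := by
  obtain ⟨a, ha, hfi⟩ := hK
  refine ⟨a, a.2, ?_, Set.range fun q : K ⧸ Subgroup.zpowers a => ((q.out : K) : G)⁻¹,
    Set.finite_range _, ?_⟩
  · rwa [Submonoid.isOfFinOrder_coe]
  intro k hk
  set q : K ⧸ Subgroup.zpowers a := QuotientGroup.mk (⟨k, hk⟩ : K)⁻¹ with hq
  obtain ⟨n, hn⟩ : q.out⁻¹ * (⟨k, hk⟩ : K)⁻¹ ∈ Subgroup.zpowers a := by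
    rw [← QuotientGroup.eq, QuotientGroup.out_eq']
  refine ⟨-n, _, ⟨q, rfl⟩, ?_⟩
  have h2 : (a : G) ^ n = (q.out : G)⁻¹ * k⁻¹ := by
    have := congrArg (fun x : K => (x : G)) hn
    simpa using this
  rw [zpow_neg, h2]
  group

lemma IsVirtuallyZPowers.map {K : Subgroup G} {t : G} (h : IsVirtuallyZPowers K t)
    {H : Type u} [Group H] {f : G →* H} (hf : Function.Injective f) :
    IsVirtuallyZPowers (K.map f) (f t) := by
  obtain ⟨R, hR, hc⟩ := h.cover
  refine ⟨⟨t, h.mem, rfl⟩, ?_, f '' R, hR.image f, ?_⟩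
  · rw [hf.isOfFinOrder_iff]
    exact h.not_isOfFinOrder
  · rintro _ ⟨k, hk, rfl⟩
    obtain ⟨n, r, hr, rfl⟩ := hc k hk
    exact ⟨n, f r, ⟨r, hr, rfl⟩, by simp⟩

lemma IsVirtuallyZPowers.zpow_injective {K : Subgroup G} {t : G} (h : IsVirtuallyZPowers K t) :
    Function.Injective fun n : ℤ => t ^ n :=
  injective_zpow_iff_not_isOfFinOrder.2 h.not_isOfFinOrder

lemma IsVirtuallyZPowers.infinite {K : Subgroup G} {t : G} (h : IsVirtuallyZPowers K t) :
    (K : Set G).Infinite :=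
  (Set.infinite_range_of_injective h.zpow_injective).mono <| by
    rintro _ ⟨n, rfl⟩
    exact K.zpow_mem h.mem n

/-- An infinite subgroup of a two-ended group has finite index. -/
lemma IsVirtuallyZPowers.cover_of_infinite {K L : Subgroup G} {t : G}
    (h : IsVirtuallyZPowers K t) (hLK : L ≤ K) (hL : (L : Set G).Infinite) :
    ∃ R : Set G, R.Finite ∧ ∀ k ∈ K, ∃ l ∈ L, ∃ r ∈ R, k = l * r := by
  obtain ⟨R, hR, hc⟩ := h.cover
  have hc' : ∀ k : G, ∃ (n : ℤ) (r : G), k ∈ K → r ∈ R ∧ k = t ^ n * r := by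
    intro k
    by_cases hk : k ∈ K
    · obtain ⟨n, r, hr, e⟩ := hc k hk
      exact ⟨n, r, fun _ => ⟨hr, e⟩⟩
    · exact ⟨0, 1, fun h => absurd h hk⟩
  choose n r hnr using hc'
  -- two elements of `L` in the same coset of the powers of `t` yield a power of `t` in `L`
  obtain ⟨x, hx, y, hy, hxy, hr⟩ := hL.exists_ne_map_eq_of_mapsTo (f := r) (t := R)
    (fun x hx => (hnr x (hLK hx)).1) hR
  have ex := (hnr x (hLK hx)).2
  have ey := (hnr y (hLK hy)).2
  have hm : t ^ (n x - n y) ∈ L := by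
    have : t ^ (n x - n y) = x * y⁻¹ := by
      have : x * y⁻¹ = t ^ n x * r x * (t ^ n y * r y)⁻¹ := congrArg₂ (fun a b => a * b⁻¹) ex ey
      rw [this, hr]
      simp [zpow_sub]
    rw [this]
    exact L.mul_mem hx (L.inv_mem hy)
  have hne : n x - n y ≠ 0 := by
    intro h0
    refine hxy (ex.trans (Eq.trans ?_ ey.symm))
    rw [hr, sub_eq_zero.1 h0]
  set m := n x - n y with hm_def
  refine ⟨Set.image2 (fun (i : ℤ) s => t ^ i * s) (Set.Ico 0 |m|) R,
    (Set.finite_Ico _ _).image2 _ hR, fun k hk => ?_⟩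
  refine ⟨t ^ (m * (n k / m)), ?_, t ^ (n k % m) * r k,
    ⟨_, ⟨Int.emod_nonneg _ hne, Int.emod_lt_abs _ hne⟩, _, (hnr k hk).1, rfl⟩, ?_⟩
  · rw [zpow_mul]
    exact L.zpow_mem hm _
  · rw [← mul_assoc, ← zpow_add, Int.mul_ediv_add_emod]
    exact (hnr k hk).2

lemma IsVirtuallyZPowers.cover_zpowers {K : Subgroup G} {t : G} (h : IsVirtuallyZPowers K t) :
    ∃ R : Set G, R.Finite ∧ ∀ k ∈ K, ∃ l ∈ Subgroup.zpowers t, ∃ r ∈ R, k = l * r := by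
  obtain ⟨R, hR, hc⟩ := h.cover
  refine ⟨R, hR, fun k hk => ?_⟩
  obtain ⟨n, r, hr, e⟩ := hc k hk
  exact ⟨t ^ n, ⟨n, rfl⟩, r, hr, e⟩

lemma exists_not_iff_succ {f : ℤ → Prop} {m n : ℤ} (hm : f m) (hn : ¬ f n) :
    ∃ i, ¬ (f i ↔ f (i + 1)) := by
  by_contra! h
  have key : ∀ i, f i ↔ f 0 := by
    intro i
    induction i using Int.induction_on with
    | zero => rfl
    | succ i ih => rw [← ih, ← h]
    | pred i ih => rw [← ih, h, sub_add_cancel]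
  exact hn ((key n).2 ((key m).1 hm))

variable {V : Type u} [MulAction G V] {T : SimpleGraph V}

/-- Some vertex lies on a deep side of every edge for the two-ended group `H`. Indeed for each
vertex there are only finitely many edges having this vertex on a shallow side, and walking across
one of them reduces their number. -/
lemma exists_forall_isDeep (hT : IsGTree G T) (hf : HasFiniteEdgeStabilizers G T) {H : Subgroup G}
    {t : G} (hH : IsVirtuallyZPowers H t) :
    ∃ y, ∀ u v, T.Adj u v → y ∈ half T u v → IsDeep T H u v := by
  let N : V → Set (V × V) := fun y =>
    {e | T.Adj e.1 e.2 ∧ y ∈ half T e.1 e.2 ∧ ¬ IsDeep T H e.1 e.2}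
  have hpow : ∀ n : ℤ, t ^ n ∈ H := fun n => H.zpow_mem hH.mem n
  have hshallow : ∀ (y : V) (u v : V), T.Adj u v → ¬ IsDeep T H u v →
      {m : ℤ | t ^ m • y ∈ half T u v}.Finite := by
    intro y u v huv hd
    have h1 : {k : G | k ∈ H ∧ k • y ∈ half T u v}.Finite :=
      Set.not_infinite.1 fun h' => hd (isDeep_of_infinite hT hf huv h')
    refine (h1.preimage hH.zpow_injective.injOn).subset ?_
    intro m hm
    exact ⟨hpow m, hm⟩
  have hfin : ∀ y, (N y).Finite := by
    intro y
    let Q : Set (V × V) := {e | T.Adj e.1 e.2 ∧ y ∈ half T e.1 e.2 ∧ t • y ∈ half T e.2 e.1}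
    have hQ : Q.Finite := finite_separating hT.isTree y (t • y)
    refine Set.Finite.subset ((hQ.subset (Set.sep_subset Q
      (fun q => ¬ IsDeep T H q.1 q.2))).biUnion (t := fun q =>
      (fun m : ℤ => (t ^ (-m) • q.1, t ^ (-m) • q.2)) '' {m : ℤ | t ^ m • y ∈ half T q.1 q.2})
      fun q hq => (hshallow y _ _ hq.1.1 hq.2).image _) ?_
    rintro ⟨u, v⟩ ⟨huv, hyu, hd⟩
    obtain ⟨n, hn, hn'⟩ : ∃ n : ℕ, t ^ n • y ∈ half T u v ∧ t ^ (n + 1) • y ∉ half T u v := by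
      by_contra! h
      have hall : ∀ n : ℕ, t ^ n • y ∈ half T u v := by
        intro n
        induction n with
        | zero => simpa using hyu
        | succ n ih => exact h n ih
      refine Set.infinite_of_injective_forall_mem (f := fun n : ℕ => (n : ℤ))
        Nat.cast_injective (fun n => ?_) (hshallow y u v huv hd)
      rw [Set.mem_ofPred_eq, zpow_natCast]
      exact hall n
    rw [Set.mem_iUnion₂]
    have hu : u = t ^ (n : ℤ) • t ^ (-(n : ℤ)) • u := by rw [zpow_neg, smul_inv_smul]
    have hv : v = t ^ (n : ℤ) • t ^ (-(n : ℤ)) • v := by rw [zpow_neg, smul_inv_smul]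
    refine ⟨(t ^ (-(n : ℤ)) • u, t ^ (-(n : ℤ)) • v), ⟨⟨hT.smul_adj _ _ _ huv, ?_, ?_⟩, ?_⟩,
      -n, ?_, ?_⟩
    · rw [hT.mem_half_smul_iff]
      simpa using hn
    · rw [← notMem_half_iff hT.isTree (hT.smul_adj _ _ _ huv), hT.mem_half_smul_iff]
      rw [pow_succ, mul_smul] at hn'
      simpa using hn'
    · rwa [isDeep_smul_of_mem hT (hpow _)]
    · rw [Set.mem_ofPred_eq, hT.smul_mem_half_iff]
      exact hyu
    · simp
  suffices ∃ y, N y = ∅ by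
    obtain ⟨y, hy⟩ := this
    refine ⟨y, fun u v huv hyu => ?_⟩
    by_contra hd
    have : (u, v) ∈ N y := ⟨huv, hyu, hd⟩
    rw [hy] at this
    exact this
  obtain ⟨y₀⟩ := hT.isTree.connected.nonempty
  suffices ∀ n y, (N y).ncard = n → ∃ y, N y = ∅ from this _ y₀ rfl
  intro n
  induction n using Nat.strong_induction_on with
  | _ n ih =>
    intro y hy
    by_cases he : N y = ∅
    · exact ⟨y, he⟩
    obtain ⟨⟨u, v⟩, huv, hyu, hd⟩ := Set.nonempty_iff_ne_empty.2 he
    have hd' : IsDeep T H v u := (isDeep_or_isDeep hT hf hH.infinite huv).resolve_left hd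
    refine ih _ ?_ v rfl
    rw [← hy]
    refine Set.ncard_lt_ncard ⟨?_, ?_⟩ (hfin y)
    · rintro ⟨c, d⟩ ⟨hcd, hvc, hdcd⟩
      refine ⟨hcd, ?_, hdcd⟩
      by_contra hyc
      have hne : s(c, d) ≠ s(u, v) := by
        intro h
        rcases Sym2.eq_iff.1 h with ⟨rfl, rfl⟩ | ⟨rfl, rfl⟩
        · exact right_notMem_half _ _ hvc
        · exact hdcd hd'
      -- the edge from `c` to `d` separates `y` from `v`, so it lies on the side of `u`
      have hcu : c ∈ half T u v := by
        by_contra hcu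
        rw [notMem_half_iff hT.isTree huv] at hcu
        have hu : u ∈ half T c d :=
          (mem_half_iff_of_adj hT.isTree hcd huv hne.symm).2 hvc
        refine hyc ((half_induction hT.isTree (a := u) (b := v) (fun z => z ∈ half T c d) hu ?_)
          y hyu)
        intro z w hzw hz hw h
        refine (mem_half_iff_of_adj hT.isTree hcd hzw ?_).1 h
        intro h'
        rcases Sym2.eq_iff.1 h' with ⟨rfl, rfl⟩ | ⟨rfl, rfl⟩
        · exact (notMem_half_iff hT.isTree huv).2 hcu hz
        · exact (notMem_half_iff hT.isTree huv).2 hcu hw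
      refine hdcd (hd'.mono_half ?_)
      have hu : u ∈ half T c d := (mem_half_iff_of_adj hT.isTree hcd huv hne.symm).2 hvc
      refine half_subset_half hT.isTree hcd huv hne.symm hu ?_
      exact (mem_half_iff_of_adj hT.isTree huv hcd hne).1 hcu
    · intro hsub
      have : (u, v) ∈ N v := hsub ⟨huv, hyu, hd⟩
      exact right_notMem_half _ _ this.2.1

/-- A two-ended group that crosses no edge fixes a vertex. -/
lemma exists_le_stabilizer_of_forall_not_crosses (hT : IsGTree G T)
    (hf : HasFiniteEdgeStabilizers G T) {H : Subgroup G} {t : G} (hH : IsVirtuallyZPowers H t)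
    (hcr : ∀ u v, T.Adj u v → ¬ Crosses T H u v) : ∃ y : V, H ≤ MulAction.stabilizer G y := by
  obtain ⟨y, hy⟩ := exists_forall_isDeep hT hf hH
  refine ⟨y, fun h hh => ?_⟩
  by_contra hne
  obtain ⟨u, v, huv, h1, h2⟩ := exists_separating hT.isTree (Ne.symm hne)
  refine hcr u v huv ⟨hy u v huv h1, ?_⟩
  rw [← isDeep_smul_of_mem hT (H.inv_mem hh)]
  refine hy _ _ (hT.smul_adj _ _ _ huv.symm) ?_
  rw [hT.mem_half_smul_iff, inv_inv]
  exact h2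

/-- Up to translation by `H`, only finitely many edges in the orbit of an edge are crossed by the
two-ended group `H`. -/
lemma exists_finite_of_crosses (hT : IsGTree G T) (hf : HasFiniteEdgeStabilizers G T)
    {H : Subgroup G} {t : G} (hH : IsVirtuallyZPowers H t) {a b : V} (hab : T.Adj a b) :
    ∃ W : Set G, W.Finite ∧ ∀ g : G, Crosses T H (g⁻¹ • a) (g⁻¹ • b) → ∃ h ∈ H, g * h ∈ W := by
  let y := a
  have hQ := finite_separating hT.isTree y (t • y)
  refine ⟨_, hQ.biUnion (t := fun q =>
    {g : G | g • q.1 = a ∧ g • q.2 = b} ∪ {g : G | g • q.1 = b ∧ g • q.2 = a})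
    fun q hq => (hf.finite_transporter hq.1 a b).union (hf.finite_transporter hq.1 b a), ?_⟩
  intro g hg
  have hadj : T.Adj (g⁻¹ • a) (g⁻¹ • b) := hT.smul_adj _ _ _ hab
  obtain ⟨R, hR, hc⟩ := hH.cover_zpowers
  obtain ⟨_, ⟨m, rfl⟩, hm⟩ := (hg.1.of_finite_cover hT hf hR hc hadj y).nonempty
  obtain ⟨_, ⟨n, rfl⟩, hn⟩ := (hg.2.of_finite_cover hT hf hR hc hadj.symm y).nonempty
  obtain ⟨i, hi⟩ := exists_not_iff_succ (f := fun i : ℤ => t ^ i • y ∈ half T (g⁻¹ • a) (g⁻¹ • b))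
    hm ((notMem_half_iff hT.isTree hadj).2 hn)
  refine ⟨t ^ i, H.zpow_mem hH.mem i, ?_⟩
  rw [Set.mem_iUnion₂]
  have e2 : t ^ i • y ∈ half T (g⁻¹ • a) (g⁻¹ • b) ↔
      y ∈ half T ((g * t ^ i)⁻¹ • a) ((g * t ^ i)⁻¹ • b) := by
    simp only [mul_inv_rev, mul_smul]
    rw [hT.mem_half_smul_iff (t ^ i)⁻¹, inv_inv]
  have e3 : t ^ (i + 1) • y ∈ half T (g⁻¹ • a) (g⁻¹ • b) ↔
      t • y ∈ half T ((g * t ^ i)⁻¹ • a) ((g * t ^ i)⁻¹ • b) := by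
    simp only [mul_inv_rev, mul_smul]
    rw [hT.mem_half_smul_iff (t ^ i)⁻¹, inv_inv, zpow_add, zpow_one, mul_smul]
  rw [e2, e3] at hi
  have hadj' : T.Adj ((g * t ^ i)⁻¹ • a) ((g * t ^ i)⁻¹ • b) := hT.smul_adj _ _ _ hab
  by_cases h : y ∈ half T ((g * t ^ i)⁻¹ • a) ((g * t ^ i)⁻¹ • b)
  · refine ⟨((g * t ^ i)⁻¹ • a, (g * t ^ i)⁻¹ • b), ⟨hadj', h, ?_⟩, Or.inl ⟨?_, ?_⟩⟩
    · rw [← notMem_half_iff hT.isTree hadj']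
      tauto
    · exact smul_inv_smul _ _
    · exact smul_inv_smul _ _
  · refine ⟨((g * t ^ i)⁻¹ • b, (g * t ^ i)⁻¹ • a), ⟨hadj'.symm, ?_, ?_⟩, Or.inr ⟨?_, ?_⟩⟩
    · rwa [← notMem_half_iff hT.isTree hadj']
    · tauto
    · exact smul_inv_smul _ _
    · exact smul_inv_smul _ _

end TwoEnded

/-! ### Replacing axes by cones -/

section Unzip

variable {G : Type u} [Group G] {V : Type u} [MulAction G V] {T : SimpleGraph V}
  {K : Subgroup G} {a b : V}

variable (G T a b) in
/-- Two vertices are related if they are joined by an edge that is not a translate of the edge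
from `a` to `b`. -/
def CollapseRel (u v : V) : Prop :=
  T.Adj u v ∧ ∀ g : G, s(u, v) ≠ s(g • a, g • b)

variable (G T a b) in
/-- The vertices of the tree obtained by collapsing all edges that are not translates of the edge
from `a` to `b`. -/
abbrev CollapsedVertex : Type u := Quot (CollapseRel G T a b)

/-- The action of `G` on the vertices of the collapsed tree. -/
abbrev collapsedAction (hT : IsGTree G T) : MulAction G (CollapsedVertex G T a b) where
  smul g := Quot.map (fun x => g • x) fun x y h => by
    refine ⟨hT.smul_adj g _ _ h.1, fun k hk => h.2 (g⁻¹ * k) ?_⟩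
    have := congrArg (Sym2.map fun z => g⁻¹ • z) hk
    simpa [mul_smul] using this
  one_smul := by
    rintro ⟨x⟩
    exact congrArg (Quot.mk _) (one_smul G x)
  mul_smul := by
    rintro g h ⟨x⟩
    exact congrArg (Quot.mk _) (mul_smul g h x)

/-- The half-trees of a translate of the edge from `a` to `b` are unions of collapsed classes. -/
lemma mem_half_iff_of_mk_eq (hT : T.IsTree) {u v : V} (huv : T.Adj u v) {g : G}
    (hg : s(u, v) = s(g • a, g • b)) {x y : V}
    (hxy : (Quot.mk _ x : CollapsedVertex G T a b) = Quot.mk _ y) :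
    x ∈ half T u v ↔ y ∈ half T u v := by
  let F : CollapsedVertex G T a b → Prop := Quot.lift (fun z => z ∈ half T u v) (by
    intro z w h
    refine propext (mem_half_iff_of_adj hT huv h.1 ?_)
    rw [hg]
    exact h.2 g)
  exact iff_of_eq (congrArg F hxy)

lemma inv_mul_mem_of_sym2_eq (hT : IsGTree G T) (hab : T.Adj a b) (hK : Crosses T K a b)
    (hu : ∀ g : G, Crosses T K (g⁻¹ • a) (g⁻¹ • b) → g ∈ K) {k g : G}
    (h : s(k • a, k • b) = s(g • a, g • b)) : k⁻¹ * g ∈ K := by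
  have h1 := congrArg (Sym2.map fun z => k⁻¹ • z) h
  simp only [Sym2.map_mk, ← mul_smul, inv_mul_cancel, one_smul] at h1
  obtain ⟨h2, h3⟩ := hT.smul_eq_of_sym2_eq hab h1.symm
  apply hu
  rwa [inv_smul_eq_iff.2 h2.symm, inv_smul_eq_iff.2 h3.symm]

lemma isDeep_of_mem_half (hT : IsGTree G T) (hab : T.Adj a b) (hK : Crosses T K a b)
    (hu : ∀ g : G, Crosses T K (g⁻¹ • a) (g⁻¹ • b) → g ∈ K) {u v x : V} {k g : G}
    (huv : T.Adj u v) (hg : s(u, v) = s(g • a, g • b)) (hgK : g ∉ K) (hk : k ∈ K)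
    (hx : x = k • a ∨ x = k • b) (hxu : x ∈ half T u v) : IsDeep T K u v := by
  have hne : s(k • a, k • b) ≠ s(u, v) := by
    intro h
    refine hgK ?_
    have := K.mul_mem hk (inv_mul_mem_of_sym2_eq hT hab hK hu (h.trans hg))
    rwa [mul_inv_cancel_left] at this
  have hc : Crosses T K (k • a) (k • b) :=
    ⟨(isDeep_smul_of_mem hT hk).2 hK.1, (isDeep_smul_of_mem hT hk).2 hK.2⟩
  have hadj := hT.smul_adj k _ _ hab
  rcases hx with rfl | rfl
  · exact hc.isDeep hT huv hadj hne hxu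
  · exact hc.symm.isDeep hT huv hadj.symm (by rwa [Sym2.eq_swap]) hxu

/-- The edges in the orbit of the edge from `a` to `b` that are crossed by `K` span, up to
collapsing, a connected subgraph. -/
lemma iff_of_mem_axis (hT : IsGTree G T) (hab : T.Adj a b) (hK : Crosses T K a b)
    (hu : ∀ g : G, Crosses T K (g⁻¹ • a) (g⁻¹ • b) → g ∈ K) (F : V → Prop)
    (hF : ∀ u v, T.Adj u v → (∀ g : G, s(u, v) = s(g • a, g • b) → g ∈ K) → (F u ↔ F v))
    {k l : G} (hk : k ∈ K) (hl : l ∈ K) {x y : V} (hx : x = k • a ∨ x = k • b)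
    (hy : y = l • a ∨ y = l • b) : F x ↔ F y := by
  refine iff_of_forall_separating hT.isTree F x y fun u v huv hxu hyv => hF u v huv fun g hg => ?_
  by_contra hgK
  have h1 : IsDeep T K u v := isDeep_of_mem_half hT hab hK hu huv hg hgK hk hx hxu
  have h2 : IsDeep T K v u :=
    isDeep_of_mem_half hT hab hK hu huv.symm (by rwa [Sym2.eq_swap]) hgK hl hy hyv
  have h3 : Crosses T K (g • a) (g • b) := by
    rcases Sym2.eq_iff.1 hg with ⟨rfl, rfl⟩ | ⟨rfl, rfl⟩
    · exact ⟨h1, h2⟩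
    · exact ⟨h2, h1⟩
  refine hgK (inv_mem_iff.1 (hu g⁻¹ ?_))
  rwa [inv_inv]

/-- The version of `iff_of_mem_axis` for the translate of the axis of `K` by a coset `q`. -/
lemma iff_of_mem_translate_axis (hT : IsGTree G T) (hab : T.Adj a b) (hK : Crosses T K a b)
    (hu : ∀ g : G, Crosses T K (g⁻¹ • a) (g⁻¹ • b) → g ∈ K) (F : V → Prop) (q : G ⧸ K)
    (hF : ∀ u v, T.Adj u v → (∀ g : G, s(u, v) = s(g • a, g • b) → (g : G ⧸ K) = q) →
      (F u ↔ F v))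
    {k l : G} (hk : (k : G ⧸ K) = q) (hl : (l : G ⧸ K) = q) {x y : V} (hx : x = k • a ∨ x = k • b)
    (hy : y = l • a ∨ y = l • b) : F x ↔ F y := by
  have := iff_of_mem_axis hT hab hK hu (fun z => F (k • z)) (k := 1) (l := k⁻¹ * l)
    (x := k⁻¹ • x) (y := k⁻¹ • y) ?_ K.one_mem ?_ ?_ ?_
  · simpa using this
  · intro u v huv h
    refine hF _ _ (hT.smul_adj k _ _ huv) fun g hg => ?_
    rw [← hk, eq_comm, QuotientGroup.eq]
    apply h
    have := congrArg (Sym2.map fun z => k⁻¹ • z) hg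
    simpa [mul_smul] using this
  · rw [← QuotientGroup.eq, hk, hl]
  · rcases hx with rfl | rfl <;> simp
  · rcases hy with rfl | rfl <;> simp [mul_smul]

variable (G T a b K) in
/-- The tree obtained by collapsing all edges that are not translates of the edge from `a` to `b`,
and by replacing each translate of the axis of `K` by the cone on its vertices. The translates
of the axis are indexed by `G ⧸ K`. -/
def unzippedGraph : SimpleGraph (CollapsedVertex G T a b ⊕ G ⧸ K) where
  Adj z w := ∃ (x : V) (g : G), (x = g • a ∨ x = g • b) ∧
    ((z = Sum.inl (Quot.mk _ x) ∧ w = Sum.inr (g : G ⧸ K)) ∨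
      (w = Sum.inl (Quot.mk _ x) ∧ z = Sum.inr (g : G ⧸ K)))
  symm := ⟨by
    rintro z w ⟨x, g, hx, h⟩
    exact ⟨x, g, hx, h.symm⟩⟩
  loopless := ⟨by
    rintro z ⟨x, g, hx, ⟨rfl, h⟩ | ⟨rfl, h⟩⟩ <;> cases h⟩

lemma unzippedGraph_adj {x : V} {g : G} (hx : x = g • a ∨ x = g • b) :
    (unzippedGraph G T K a b).Adj (Sum.inl (Quot.mk _ x)) (Sum.inr (g : G ⧸ K)) :=
  ⟨x, g, hx, Or.inl ⟨rfl, rfl⟩⟩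

lemma unzippedGraph_connected (hT : T.IsTree) : (unzippedGraph G T K a b).Connected := by
  have key : ∀ x y : V, (unzippedGraph G T K a b).Reachable
      (Sum.inl (Quot.mk _ x)) (Sum.inl (Quot.mk _ y)) := by
    intro x y
    obtain ⟨p⟩ := hT.connected.preconnected x y
    induction p with
    | nil => rfl
    | @cons x z y hxz p ih =>
      refine SimpleGraph.Reachable.trans ?_ ih
      by_cases h : CollapseRel G T a b x z
      · rw [Quot.sound h]
      · obtain ⟨g, hg⟩ : ∃ g : G, s(x, z) = s(g • a, g • b) := by
          by_contra! h'
          exact h ⟨hxz, h'⟩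
        have hx : x = g • a ∨ x = g • b := by
          rcases Sym2.eq_iff.1 hg with h | h
          exacts [Or.inl h.1, Or.inr h.1]
        have hz : z = g • a ∨ z = g • b := by
          rcases Sym2.eq_iff.1 hg with h | h
          exacts [Or.inr h.2, Or.inl h.2]
        exact (unzippedGraph_adj hx).reachable.trans (unzippedGraph_adj hz).symm.reachable
  have key' : ∀ z, (unzippedGraph G T K a b).Reachable (Sum.inl (Quot.mk _ a)) z := by
    rintro (⟨⟨x⟩⟩ | ⟨⟨g⟩⟩)
    · exact key a x
    · exact (key a (g • a)).trans (unzippedGraph_adj (Or.inl rfl)).reachable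
  have : Nonempty (CollapsedVertex G T a b ⊕ G ⧸ K) := ⟨Sum.inl (Quot.mk _ a)⟩
  exact ⟨fun z w => (key' z).symm.trans (key' w)⟩

/-- The unzipped graph is a tree. The function certifying that the edge joining the class of `x₀`
to the axis `q₀` is a bridge singles out the part of the tree which is reached from the class of
`x₀` through an edge of the axis `q₀`. -/
lemma unzippedGraph_isTree (hT : IsGTree G T) (hab : T.Adj a b) (hK : Crosses T K a b)
    (hu : ∀ g : G, Crosses T K (g⁻¹ • a) (g⁻¹ • b) → g ∈ K) :
    (unzippedGraph G T K a b).IsTree := by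
  let mk : V → CollapsedVertex G T a b := Quot.mk _
  refine isTree_of_forall_adj_exists (unzippedGraph_connected hT.isTree) ?_
  suffices h : ∀ (x₀ : V) (g₀ : G), (x₀ = g₀ • a ∨ x₀ = g₀ • b) →
      ∃ f : CollapsedVertex G T a b ⊕ G ⧸ K → Prop,
        ¬ f (Sum.inl (mk x₀)) ∧ f (Sum.inr g₀) ∧
        ∀ (x : V) (g : G), (x = g • a ∨ x = g • b) →
          ¬ (f (Sum.inl (mk x)) ↔ f (Sum.inr g)) → mk x = mk x₀ ∧ (g : G ⧸ K) = g₀ by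
    rintro z w ⟨x₀, g₀, hx₀, hzw⟩
    obtain ⟨f, hf1, hf2, hf3⟩ := h x₀ g₀ hx₀
    have hsym : s(z, w) = s(Sum.inl (mk x₀), Sum.inr (g₀ : G ⧸ K)) := by
      rcases hzw with ⟨rfl, rfl⟩ | ⟨rfl, rfl⟩
      · rfl
      · exact Sym2.eq_swap
    refine ⟨Prop, f, ?_, ?_⟩
    · rcases hzw with ⟨rfl, rfl⟩ | ⟨rfl, rfl⟩
      · exact fun h => hf1 (iff_of_eq h |>.2 hf2)
      · exact fun h => hf1 (iff_of_eq h |>.1 hf2)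
    · rintro z' w' ⟨x, g, hx, ⟨rfl, rfl⟩ | ⟨rfl, rfl⟩⟩ hne
      · obtain ⟨h1, h2⟩ := hf3 x g hx fun h => hne (propext h)
        rw [hsym, ← h1, ← h2]
      · obtain ⟨h1, h2⟩ := hf3 x g hx fun h => hne (propext h.symm)
        rw [hsym, ← h1, ← h2]
        exact Sym2.eq_swap
  intro x₀ g₀ hx₀
  let F : V → Prop := fun x => ∃ u v, T.Adj u v ∧ mk v = mk x₀ ∧
    (∃ g : G, (g : G ⧸ K) = g₀ ∧ s(u, v) = s(g • a, g • b)) ∧ x ∈ half T u v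
  have F1 : ∀ x y, T.Adj x y → F x → ¬ F y →
      mk y = mk x₀ ∧ ∃ g : G, (g : G ⧸ K) = g₀ ∧ s(x, y) = s(g • a, g • b) := by
    rintro x y hxy ⟨u, v, huv, hv, hg, hx⟩ hy
    obtain ⟨rfl, rfl⟩ := eq_of_mem_half_of_notMem_half hT.isTree huv hxy hx
      fun h => hy ⟨u, v, huv, hv, hg, h⟩
    exact ⟨hv, hg⟩
  have F2 : ∀ x y, T.Adj x y → (∀ g : G, s(x, y) = s(g • a, g • b) → (g : G ⧸ K) ≠ g₀) →
      (F x ↔ F y) := by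
    intro x y hxy hg
    constructor
    · intro hx
      by_contra hy
      obtain ⟨-, g, h1, h2⟩ := F1 x y hxy hx hy
      exact hg g h2 h1
    · intro hy
      by_contra hx
      obtain ⟨-, g, h1, h2⟩ := F1 y x hxy.symm hy hx
      exact hg g (Sym2.eq_swap.trans h2) h1
  have F3 : ∀ x, mk x = mk x₀ → ¬ F x := by
    rintro x hx ⟨u, v, huv, hv, ⟨g, -, hg⟩, h⟩
    exact right_notMem_half _ _ ((mem_half_iff_of_mk_eq hT.isTree huv hg (hx.trans hv.symm)).1 h)
  let Fq : CollapsedVertex G T a b → Prop := Quot.lift F fun x y h =>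
    propext (F2 x y h.1 fun g hg => absurd hg (h.2 g))
  refine ⟨Sum.elim Fq fun q => q = g₀ ∨ ∃ g : G, (g : G ⧸ K) = q ∧ F (g • a), F3 x₀ rfl,
    Or.inl rfl, ?_⟩
  intro x g hx hne
  change ¬ (F x ↔ ((g : G ⧸ K) = g₀ ∨ ∃ g' : G, (g' : G ⧸ K) = g ∧ F (g' • a))) at hne
  by_cases hg : (g : G ⧸ K) = g₀
  · refine ⟨?_, hg⟩
    have hFx : ¬ F x := fun h => hne (iff_of_true h (Or.inl hg))
    have step : ∀ x y, T.Adj x y → (∀ g : G, s(x, y) = s(g • a, g • b) → (g : G ⧸ K) = g₀) →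
        (F y ∨ mk y = mk x₀) → (F x ∨ mk x = mk x₀) := by
      intro x y hxy hlab h
      by_cases hc : CollapseRel G T a b x y
      · have hmk : mk x = mk y := Quot.sound hc
        rw [hmk]
        rwa [F2 x y hxy fun g hg => absurd hg (hc.2 g)]
      obtain ⟨g, hg⟩ : ∃ g : G, s(x, y) = s(g • a, g • b) := by
        by_contra! h'
        exact hc ⟨hxy, h'⟩
      rcases h with h | h
      · by_contra! h'
        exact h'.2 (F1 y x hxy.symm h h'.1).1
      · exact Or.inl ⟨x, y, hxy, h, ⟨g, hlab g hg, hg⟩, left_mem_half hxy⟩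
    have hP := iff_of_mem_translate_axis hT hab hK hu (fun z => F z ∨ mk z = mk x₀) g₀
      (fun u v huv h => ⟨step v u huv.symm fun g hg => h g (Sym2.eq_swap.trans hg),
        step u v huv h⟩) hg rfl hx hx₀
    exact (hP.2 (Or.inr rfl)).resolve_left hFx
  · exfalso
    have hFF : ∀ g' : G, (g' : G ⧸ K) = g → (F x ↔ F (g' • a)) := fun g' hg' =>
      iff_of_mem_translate_axis hT hab hK hu F g
        (fun u v huv h => F2 u v huv fun k hk => h k hk ▸ hg) rfl hg' hx (Or.inl rfl)
    refine hne ⟨fun h => Or.inr ⟨g, rfl, (hFF g rfl).1 h⟩, ?_⟩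
    rintro (h | ⟨g', hg', h⟩)
    · exact absurd h hg
    · exact (hFF g' hg').2 h

/-- Let `S` be a set of representatives of the conjugacy classes in a family `𝓗` of two-ended
subgroups. If some edge of a `G`-tree with finite edge stabilisers is crossed by exactly one
translate of exactly one member of `S`, then `G` splits over a finite group relative to `𝓗`. -/
theorem splitsOverFiniteRel_of_unique_crosses (hT : IsGTree G T)
    (hf : HasFiniteEdgeStabilizers G T) {𝓗 S : Set (Subgroup G)}
    (h2 : ∀ H ∈ 𝓗, ∃ t, IsVirtuallyZPowers H t) (hS𝓗 : S ⊆ 𝓗)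
    (hS : ∀ L ∈ 𝓗, ∃ H ∈ S, AreConj H L) (hKS : K ∈ S) (hne : 𝓗 ≠ {⊤})
    (hab : T.Adj a b) (hK : Crosses T K a b)
    (huniq : ∀ H ∈ S, ∀ g : G, Crosses T H (g⁻¹ • a) (g⁻¹ • b) → H = K ∧ g ∈ K) :
    SplitsOverFiniteRel G 𝓗 := by
  let _ := collapsedAction (a := a) (b := b) hT
  have hu : ∀ g : G, Crosses T K (g⁻¹ • a) (g⁻¹ • b) → g ∈ K := fun g hg => (huniq K hKS g hg).2
  let mk : V → CollapsedVertex G T a b := Quot.mk _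
  have smul_mk : ∀ (g : G) (x : V), g • mk x = mk (g • x) := fun _ _ => rfl
  have hfin : ∀ (x : V) (g : G), (x = g • a ∨ x = g • b) → Finite (edgeStabilizer G
      (Sum.inl (mk x) : CollapsedVertex G T a b ⊕ G ⧸ K) (Sum.inr (g : G ⧸ K))) := by
    intro x g hx
    rw [← not_infinite_iff_finite]
    intro hinf
    set L := edgeStabilizer G
      (Sum.inl (mk x) : CollapsedVertex G T a b ⊕ G ⧸ K) (Sum.inr (g : G ⧸ K)) with hL
    have hLinf : (L : Set G).Infinite := Set.infinite_coe_iff.1 hinf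
    obtain ⟨t, ht⟩ := h2 K (hS𝓗 hKS)
    have hLK : L ≤ K.map (MulAut.conj g).toMonoidHom := by
      rintro l ⟨-, hl⟩
      have h1 : l • (g : G ⧸ K) = g := Sum.inr_injective hl
      have h3 : ((l * g : G) : G ⧸ K) = g := h1
      rw [eq_comm, QuotientGroup.eq] at h3
      exact ⟨_, h3, by simp [MulAut.conj_apply]⟩
    obtain ⟨R, hR, hc⟩ := (ht.map (f := (MulAut.conj g).toMonoidHom)
      (MulAut.conj g).injective).cover_of_infinite hLK hLinf
    have hcr : Crosses T (K.map (MulAut.conj g).toMonoidHom) (g • a) (g • b) := by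
      rw [crosses_map_conj hT, inv_smul_smul, inv_smul_smul]
      exact hK
    have hadj := hT.smul_adj g _ _ hab
    have hmem : ∀ l ∈ L, mk (l • x) = mk x := fun l hl => Sum.inl_injective hl.1
    rcases hx with rfl | rfl
    · obtain ⟨l, hl, hl'⟩ := (hcr.2.of_finite_cover hT hf hR hc hadj.symm (g • a)).nonempty
      exact right_notMem_half _ _ ((mem_half_iff_of_mk_eq hT.isTree hadj.symm (g := g)
        Sym2.eq_swap (hmem l hl)).1 hl')
    · obtain ⟨l, hl, hl'⟩ := (hcr.1.of_finite_cover hT hf hR hc hadj (g • b)).nonempty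
      exact right_notMem_half _ _ ((mem_half_iff_of_mk_eq hT.isTree hadj (g := g)
        rfl (hmem l hl)).1 hl')
  refine ⟨CollapsedVertex G T a b ⊕ G ⧸ K, inferInstance, unzippedGraph G T K a b,
    ⟨unzippedGraph_isTree hT hab hK hu, ?_, ?_⟩, ?_, ?_, ?_⟩
  · rintro k z w ⟨x, g, hx, h⟩
    refine ⟨k • x, k * g, ?_, ?_⟩
    · rcases hx with rfl | rfl <;> simp [mul_smul]
    · rcases h with ⟨rfl, rfl⟩ | ⟨rfl, rfl⟩
      exacts [Or.inl ⟨rfl, rfl⟩, Or.inr ⟨rfl, rfl⟩]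
  · rintro k z w ⟨x, g, hx, ⟨rfl, rfl⟩ | ⟨rfl, rfl⟩⟩ ⟨h, -⟩ <;> cases h
  · rintro z w ⟨x, g, hx, ⟨rfl, rfl⟩ | ⟨rfl, rfl⟩⟩
    · exact hfin x g hx
    · have := hfin x g hx
      rwa [edgeStabilizer, inf_comm] at this
  · rintro (⟨⟨x⟩⟩ | ⟨⟨g⟩⟩) h
    · -- the class of `x` lies on one side of the edge from `a` to `b`, but `K` is deep in both
      have hmem : ∀ k : G, mk (k • x) = mk x := by
        intro k
        have : k ∈ MulAction.stabilizer G
          (Sum.inl (mk x) : CollapsedVertex G T a b ⊕ G ⧸ K) := h ▸ Subgroup.mem_top k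
        exact Sum.inl_injective this
      obtain ⟨k, -, hk⟩ := (hK.1 x).nonempty
      obtain ⟨l, -, hl⟩ := (hK.2 x).nonempty
      refine (notMem_half_iff hT.isTree hab).2 hl ?_
      exact (mem_half_iff_of_mk_eq hT.isTree hab (g := 1) (by simp)
        ((hmem k).trans (hmem l).symm)).1 hk
    · have hKtop : K = ⊤ := by
        rw [eq_top_iff]
        intro k _
        have : (g * k * g⁻¹) ∈ MulAction.stabilizer G
          (Sum.inr (g : G ⧸ K) : CollapsedVertex G T a b ⊕ G ⧸ K) := h ▸ Subgroup.mem_top _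
        have h1 : (g * k * g⁻¹) • (g : G ⧸ K) = g := Sum.inr_injective this
        have h3 : ((g * k * g⁻¹ * g : G) : G ⧸ K) = g := h1
        rw [eq_comm, QuotientGroup.eq] at h3
        simpa using h3
      -- every infinite subgroup of the two-ended group `G` crosses the edge from `a` to `b`
      obtain ⟨t, ht⟩ := h2 K (hS𝓗 hKS)
      have hStop : ∀ H ∈ S, H = ⊤ := by
        intro H hH
        obtain ⟨s, hs⟩ := h2 H (hS𝓗 hH)
        obtain ⟨R, hR, hc⟩ := ht.cover_of_infinite (hKtop ▸ le_top) hs.infinite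
        rw [← hKtop]
        refine (huniq H hH 1 ?_).1
        rw [inv_one, one_smul, one_smul]
        exact ⟨hK.1.of_finite_cover hT hf hR hc hab, hK.2.of_finite_cover hT hf hR hc hab.symm⟩
      refine hne (Set.eq_singleton_iff_unique_mem.2 ⟨hKtop ▸ hS𝓗 hKS, fun L hL => ?_⟩)
      obtain ⟨H, hH, g, rfl⟩ := hS L hL
      rw [hStop H hH]
      exact Subgroup.map_top_of_surjective _ (MulAut.conj g).surjective
  · intro L hL
    obtain ⟨H, hH, g, rfl⟩ := hS L hL
    by_cases hHK : H = K
    · subst hHK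
      refine ⟨Sum.inr (g : G ⧸ H), ?_⟩
      rintro _ ⟨k, hk, rfl⟩
      refine congrArg Sum.inr ?_
      change ((g * k * g⁻¹ * g : G) : G ⧸ H) = g
      rw [eq_comm, QuotientGroup.eq]
      simpa using hk
    · obtain ⟨t, ht⟩ := h2 _ hL
      obtain ⟨y, hy⟩ := exists_forall_isDeep hT hf ht
      refine ⟨Sum.inl (mk y), fun h hh => congrArg Sum.inl ?_⟩
      refine (iff_of_forall_separating hT.isTree (fun z => mk y = mk z) y (h • y) ?_).1 rfl |>.symm
      intro u v huv h1 h3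
      suffices hc : CollapseRel G T a b u v by
        have : mk u = mk v := Quot.sound hc
        rw [this]
      refine ⟨huv, fun k hk => hHK ?_⟩
      have hcr : Crosses T (H.map (MulAut.conj g).toMonoidHom) u v := by
        refine ⟨hy u v huv h1, ?_⟩
        rw [← isDeep_smul_of_mem hT (inv_mem hh)]
        refine hy _ _ (hT.smul_adj _ _ _ huv.symm) ?_
        rw [hT.mem_half_smul_iff, inv_inv]
        exact h3
      have hcr' : Crosses T (H.map (MulAut.conj g).toMonoidHom) (k • a) (k • b) := by
        rcases Sym2.eq_iff.1 hk with ⟨rfl, rfl⟩ | ⟨rfl, rfl⟩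
        exacts [hcr, hcr.symm]
      rw [crosses_map_conj hT] at hcr'
      refine (huniq H hH (k⁻¹ * g) ?_).1
      simpa [mul_smul] using hcr'

end Unzip

/-! ### The double and its crossed homomorphisms -/

namespace Double

variable {G : Type u} [Group G] {S : Set (Subgroup G)} (K₀ : S)

/-- The inclusions of the two copies of `G`, the first one for `false`, the second one for
`true`. -/
def incl (c : Bool) : G →* Double S K₀ :=
  (QuotientGroup.mk' _).comp (cond c (DoubleGenerators.right S) (DoubleGenerators.left S))

/-- The stable letter of an edge. -/
def letter (K : S) : Double S K₀ :=
  QuotientGroup.mk' _ (DoubleGenerators.letter S K)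

lemma letter_base : letter K₀ K₀ = 1 :=
  (QuotientGroup.eq_one_iff _).2 (Subgroup.subset_normalClosure (Or.inl rfl))

lemma letter_mul_incl (K : S) {k : G} (hk : k ∈ (K : Subgroup G)) :
    letter K₀ K * incl K₀ false k = incl K₀ true k * letter K₀ K := by
  have h : (QuotientGroup.mk' (Subgroup.normalClosure (doubleRelations S K₀)))
      (DoubleGenerators.letter S K * DoubleGenerators.left S k *
        (DoubleGenerators.letter S K)⁻¹ * (DoubleGenerators.right S k)⁻¹) = 1 :=
    (QuotientGroup.eq_one_iff _).2 (Subgroup.subset_normalClosure (Or.inr ⟨K, k, hk, rfl⟩))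
  rw [map_mul, map_mul, map_mul, map_inv, map_inv, mul_inv_eq_one, mul_inv_eq_iff_eq_mul] at h
  exact h

lemma map_incl_true (K : S) : (K : Subgroup G).map (incl K₀ true) =
    ((K : Subgroup G).map (incl K₀ false)).map (MulAut.conj (letter K₀ K)).toMonoidHom := by
  rw [Subgroup.map_map]
  have h : ∀ k ∈ (K : Subgroup G), incl K₀ true k =
      ((MulAut.conj (letter K₀ K)).toMonoidHom.comp (incl K₀ false)) k := by
    intro k hk
    change _ = letter K₀ K * incl K₀ false k * (letter K₀ K)⁻¹
    rw [letter_mul_incl K₀ K hk, mul_inv_cancel_right]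
  ext z
  constructor
  · rintro ⟨k, hk, rfl⟩
    exact ⟨k, hk, (h k hk).symm⟩
  · rintro ⟨k, hk, rfl⟩
    exact ⟨k, hk, h k hk⟩

section Lift

variable {H : Type*} [Group H]

/-- The universal property of the double. -/
def lift (f : Bool → G →* H) (τ : S → H) (h0 : τ K₀ = 1)
    (h : ∀ (K : S), ∀ k ∈ (K : Subgroup G), τ K * f false k = f true k * τ K) :
    Double S K₀ →* H :=
  QuotientGroup.lift _
    (Monoid.Coprod.lift (Monoid.Coprod.lift (f false) (f true)) (FreeGroup.lift τ)) <| by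
    refine Subgroup.normalClosure_le_normal ?_
    rintro w (rfl | ⟨K, k, hk, rfl⟩)
    · simpa [MonoidHom.mem_ker, DoubleGenerators.letter] using h0
    · simp [MonoidHom.mem_ker, DoubleGenerators.letter, DoubleGenerators.left,
        DoubleGenerators.right, h K k hk]

variable {K₀}

@[simp] lemma lift_incl (f : Bool → G →* H) (τ : S → H) (h0 : τ K₀ = 1)
    (h : ∀ (K : S), ∀ k ∈ (K : Subgroup G), τ K * f false k = f true k * τ K) (c : Bool) (g : G) :
    lift K₀ f τ h0 h (incl K₀ c g) = f c g := by
  cases c <;> simp [lift, incl, DoubleGenerators.left, DoubleGenerators.right]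

@[simp] lemma lift_letter (f : Bool → G →* H) (τ : S → H) (h0 : τ K₀ = 1)
    (h : ∀ (K : S), ∀ k ∈ (K : Subgroup G), τ K * f false k = f true k * τ K) (K : S) :
    lift K₀ f τ h0 h (letter K₀ K) = τ K := by
  simp [lift, letter, DoubleGenerators.letter]

lemma hom_ext {f f' : Double S K₀ →* H} (h1 : ∀ c g, f (incl K₀ c g) = f' (incl K₀ c g))
    (h2 : ∀ K, f (letter K₀ K) = f' (letter K₀ K)) : f = f' := by
  refine QuotientGroup.monoidHom_ext _ (Monoid.Coprod.hom_ext (Monoid.Coprod.hom_ext ?_ ?_) ?_)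
  · exact MonoidHom.ext (h1 false)
  · exact MonoidHom.ext (h1 true)
  · exact FreeGroup.ext_hom _ _ h2

end Lift

variable {K₀} in
lemma subgroup_eq_top {L : Subgroup (Double S K₀)} (h1 : ∀ c g, incl K₀ c g ∈ L)
    (h2 : ∀ K, letter K₀ K ∈ L) : L = ⊤ := by
  let f : Double S K₀ →* L := lift K₀ (fun c => (incl K₀ c).codRestrict L (h1 c))
    (fun K => ⟨letter K₀ K, h2 K⟩) (Subtype.ext (letter_base K₀))
    (fun K k hk => Subtype.ext (letter_mul_incl K₀ K hk))
  have hf : L.subtype.comp f = MonoidHom.id _ := hom_ext (by simp [f]) (by simp [f])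
  rw [eq_top_iff]
  intro d _
  have : (f d : Double S K₀) = d := DFunLike.congr_fun hf d
  exact this ▸ (f d).2

/-- The retraction of the double onto `G` that identifies the two copies of `G` and kills the
stable letters. -/
def retract : Double S K₀ →* G :=
  lift K₀ (fun _ => MonoidHom.id G) (fun _ => 1) rfl (by simp)

variable {K₀}

@[simp] lemma retract_incl (c : Bool) (g : G) : retract K₀ (incl K₀ c g) = g := by
  simp [retract]

@[simp] lemma retract_letter (K : S) : retract K₀ (letter K₀ K) = 1 := by
  simp [retract]

lemma incl_injective (c : Bool) : Function.Injective (incl K₀ c) :=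
  Function.LeftInverse.injective (g := retract K₀) (retract_incl c)

/-- Crossed homomorphisms on the double can be prescribed on the generators, subject to the
relations: they are the sections of a semidirect product. -/
lemma exists_crossedHom {M : Type*} [Group M] (φ : Double S K₀ →* MulAut M) (δ : Bool → G → M)
    (hδ : ∀ c g h, δ c (g * h) = δ c g * φ (incl K₀ c g) (δ c h)) (τ : S → M) (h0 : τ K₀ = 1)
    (hτ : ∀ (K : S), ∀ k ∈ (K : Subgroup G),
      τ K * φ (letter K₀ K) (δ false k) = δ true k * φ (incl K₀ true k) (τ K)) :
    ∃ Δ : Double S K₀ → M, (∀ x y, Δ (x * y) = Δ x * φ x (Δ y)) ∧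
      (∀ c g, Δ (incl K₀ c g) = δ c g) ∧ ∀ K, Δ (letter K₀ K) = τ K := by
  let f : Double S K₀ →* M ⋊[φ] Double S K₀ := lift K₀
    (fun c => MonoidHom.mk' (fun g => ⟨δ c g, incl K₀ c g⟩) fun g h =>
      SemidirectProduct.ext (by simp [hδ]) (by simp))
    (fun K => ⟨τ K, letter K₀ K⟩) (SemidirectProduct.ext h0 (letter_base K₀))
    (fun K k hk => SemidirectProduct.ext (by simpa using hτ K k hk)
      (by simpa using letter_mul_incl K₀ K hk))
  have hf : SemidirectProduct.rightHom.comp f = MonoidHom.id _ :=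
    hom_ext (by simp [f]) (by simp [f])
  refine ⟨fun d => (f d).left, fun x y => ?_, by simp [f], by simp [f]⟩
  have hx : (f x).right = x := DFunLike.congr_fun hf x
  change (f (x * y)).left = _
  rw [map_mul, SemidirectProduct.mul_left, hx]

end Double

/-! ### Gluing copies of a tree -/

open Double

section EdgeFunction

variable {G : Type u} [Group G] {S : Set (Subgroup G)} {K₀ : S} {V : Type u}

variable (K₀ V) in
/-- Functions on the oriented edges of all the copies of a `G`-tree. -/
abbrev EdgeFunction : Type u := Bool → Double S K₀ → V → V → ℤˣ

variable (K₀ V) in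
/-- The translation action of the double on edge functions. -/
def translate : Double S K₀ →* MulAut (EdgeFunction K₀ V) where
  toFun d :=
    { toFun := fun f c e => f c (d⁻¹ * e)
      invFun := fun f c e => f c (d * e)
      left_inv := fun f => by simp
      right_inv := fun f => by simp
      map_mul' := fun f f' => rfl }
  map_one' := by
    ext f c e
    simp
  map_mul' d d' := by
    ext f c e
    simp [mul_assoc]

lemma translate_apply (d : Double S K₀) (f : EdgeFunction K₀ V) (c : Bool) (e : Double S K₀) :
    translate K₀ V d f c e = f c (d⁻¹ * e) := rfl

end EdgeFunction

section Glue

variable {G : Type u} [Group G] {S : Set (Subgroup G)} {K₀ : S} {V : Type u} [MulAction G V]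

variable (K₀) in
/-- The gluing relation: vertices of the copies `{c} × {d} × V` of a `G`-tree are identified
according to the two embeddings of `G` into the double, and the vertices `p K` are identified across
the edges of the Bass-Serre tree of the double. Elements of the double act by left multiplication on
the index `d`. -/
inductive GlueRel (p : S → V) :
    Bool × Double S K₀ × V → Bool × Double S K₀ × V → Prop
  | smul (c : Bool) (d : Double S K₀) (g : G) (x : V) :
      GlueRel p (c, d * incl K₀ c g, x) (c, d, g • x)
  | glue (d : Double S K₀) (K : S) :
      GlueRel p (false, d * letter K₀ K, p K) (true, d, p K)

variable (K₀) in
/-- The vertices of the tree for the double that is glued from copies of a `G`-tree. -/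
def GlueVertex (p : S → V) : Type u := Quot (GlueRel K₀ p)

namespace GlueVertex

variable {p : S → V}

/-- The vertex `x` of the copy of the `G`-tree with index `(c, d)`. -/
def mk (p : S → V) (c : Bool) (d : Double S K₀) (x : V) : GlueVertex K₀ p := Quot.mk _ (c, d, x)

lemma mk_mul_incl (c : Bool) (d : Double S K₀) (g : G) (x : V) :
    mk p c (d * incl K₀ c g) x = mk p c d (g • x) :=
  Quot.sound (GlueRel.smul c d g x)

lemma mk_mul_letter (d : Double S K₀) (K : S) :
    mk p false (d * letter K₀ K) (p K) = mk p true d (p K) :=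
  Quot.sound (GlueRel.glue d K)

instance : MulAction (Double S K₀) (GlueVertex K₀ p) where
  smul e := Quot.map (fun z => (z.1, e * z.2.1, z.2.2)) (by
    rintro _ _ (⟨c, d, g, x⟩ | ⟨d, K⟩)
    · simpa only [mul_assoc] using GlueRel.smul (p := p) c (e * d) g x
    · simpa only [mul_assoc] using GlueRel.glue (p := p) (e * d) K)
  one_smul := by
    rintro ⟨c, d, x⟩
    exact congrArg (fun e => mk p c e x) (one_mul d)
  mul_smul := by
    rintro e e' ⟨c, d, x⟩
    exact congrArg (fun e => mk p c e x) (mul_assoc e e' d)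

lemma smul_mk (e : Double S K₀) (c : Bool) (d : Double S K₀) (x : V) :
    e • mk p c d x = mk p c (e * d) x := rfl

/-- The retraction of the glued tree onto the original one. -/
def proj : GlueVertex K₀ p → V :=
  Quot.lift (fun z => retract K₀ z.2.1 • z.2.2) (by
    rintro _ _ (⟨c, d, g, x⟩ | ⟨d, K⟩)
    · simp [mul_smul]
    · simp)

lemma proj_mk (c : Bool) (d : Double S K₀) (x : V) :
    proj (mk p c d x) = retract K₀ d • x := rfl

lemma proj_smul (e : Double S K₀) (z : GlueVertex K₀ p) :
    proj (e • z) = retract K₀ e • proj z := by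
  obtain ⟨c, d, x⟩ := z
  change proj (mk p c (e * d) x) = retract K₀ e • proj (mk p c d x)
  rw [proj_mk, proj_mk, map_mul, mul_smul]

end GlueVertex

open GlueVertex

variable {T : SimpleGraph V} {p : S → V}

variable (K₀ T p) in
/-- The graph for the double that is glued from copies of a `G`-tree. -/
def glueGraph : SimpleGraph (GlueVertex K₀ p) where
  Adj z w := ∃ (c : Bool) (d : Double S K₀) (x y : V),
    T.Adj x y ∧ z = mk p c d x ∧ w = mk p c d y
  symm := ⟨by
    rintro _ _ ⟨c, d, x, y, h, rfl, rfl⟩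
    exact ⟨c, d, y, x, h.symm, rfl, rfl⟩⟩
  loopless := ⟨by
    rintro _ ⟨c, d, x, y, h, rfl, h'⟩
    have := congrArg proj h'
    rw [proj_mk, proj_mk, smul_left_cancel_iff] at this
    exact h.ne this⟩

lemma glueGraph_adj (c : Bool) (d : Double S K₀) {x y : V} (h : T.Adj x y) :
    (glueGraph K₀ T p).Adj (mk p c d x) (mk p c d y) :=
  ⟨c, d, x, y, h, rfl, rfl⟩

lemma glueGraph_connected (hT : T.Connected) : (glueGraph K₀ T p).Connected := by
  have h1 : ∀ (c : Bool) (d : Double S K₀) (x y : V),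
      (glueGraph K₀ T p).Reachable (mk p c d x) (mk p c d y) := by
    intro c d x y
    let f : T →g glueGraph K₀ T p := ⟨fun x => mk p c d x, fun h => glueGraph_adj c d h⟩
    exact (hT.preconnected x y).map f
  let z₀ : GlueVertex K₀ p := mk p false 1 (p K₀)
  have hz₀ : z₀ = mk p true 1 (p K₀) := by
    have := mk_mul_letter (K₀ := K₀) (p := p) 1 K₀
    rwa [letter_base, mul_one] at this
  let smulHom (e : Double S K₀) : glueGraph K₀ T p →g glueGraph K₀ T p :=
    ⟨fun z => e • z, by
      rintro _ _ ⟨c, d, x, y, h, rfl, rfl⟩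
      exact glueGraph_adj c (e * d) h⟩
  let L : Subgroup (Double S K₀) :=
    { carrier := {d | (glueGraph K₀ T p).Reachable z₀ (d • z₀)}
      one_mem' := by
        rw [Set.mem_ofPred_eq, one_smul]
      mul_mem' := by
        intro d e hd he
        rw [Set.mem_ofPred_eq] at *
        rw [mul_smul]
        exact hd.trans (he.map (smulHom d))
      inv_mem' := by
        intro d hd
        rw [Set.mem_ofPred_eq] at *
        have := hd.map (smulHom d⁻¹)
        change (glueGraph K₀ T p).Reachable (d⁻¹ • z₀) (d⁻¹ • d • z₀) at this
        rw [inv_smul_smul] at this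
        exact this.symm }
  have hz₀' : ∀ c, z₀ = mk p c 1 (p K₀) := by
    rintro (_ | _)
    exacts [rfl, hz₀]
  have hL : L = ⊤ := by
    refine subgroup_eq_top (fun c g => ?_) fun K => ?_
    · change (glueGraph K₀ T p).Reachable z₀ (incl K₀ c g • z₀)
      rw [hz₀' c, smul_mk, mul_one, ← one_mul (incl K₀ c g), mk_mul_incl]
      exact h1 _ _ _ _
    · change (glueGraph K₀ T p).Reachable z₀ (letter K₀ K • z₀)
      rw [smul_mk, mul_one]
      refine SimpleGraph.Reachable.trans ?_ (h1 false (letter K₀ K) (p K) (p K₀))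
      rw [← one_mul (letter K₀ K), mk_mul_letter, hz₀]
      exact h1 _ _ _ _
  have h2 : ∀ z, (glueGraph K₀ T p).Reachable z₀ z := by
    rintro ⟨c, d, x⟩
    have hd : d ∈ L := hL ▸ Subgroup.mem_top d
    refine SimpleGraph.Reachable.trans (v := d • z₀) hd ?_
    rw [hz₀' c, smul_mk, mul_one]
    exact h1 c d _ _
  have : Nonempty (GlueVertex K₀ p) := ⟨z₀⟩
  exact ⟨fun z w => (h2 z).symm.trans (h2 w)⟩

open Classical in
variable (T) in
/-- The sign of a vertex with respect to an oriented edge of the tree. -/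
noncomputable def sideSign (a b x : V) : ℤˣ := if x ∈ half T a b then 1 else -1

lemma sym2_eq_of_sideSign_ne (hT : T.IsTree) {a b x y : V} (hab : T.Adj a b) (hxy : T.Adj x y)
    (h : sideSign T a b x ≠ sideSign T a b y) : s(x, y) = s(a, b) := by
  by_contra hne
  refine h ?_
  classical
  exact if_congr (mem_half_iff_of_adj hT hab hxy hne) rfl rfl

open Classical in
variable (K₀ T) in
/-- The edge function which takes the value `-1` exactly on those edges of the copies of the tree
that, after translation to the copy with index `(c, 1)`, separate `x` from `y`. -/
noncomputable def separation (c : Bool) (x y : V) : EdgeFunction K₀ V := fun c' e a b =>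
  if c' = c ∧ e = incl K₀ c (retract K₀ e) then
    sideSign T a b ((retract K₀ e)⁻¹ • y) / sideSign T a b ((retract K₀ e)⁻¹ • x)
  else 1

lemma separation_self (c : Bool) (x : V) : separation K₀ T c x x = 1 := by
  funext c' e a b
  simp [separation]

lemma separation_mul (c : Bool) (x y z : V) :
    separation K₀ T c x y * separation K₀ T c y z = separation K₀ T c x z := by
  funext c' e a b
  simp only [Pi.mul_apply, separation]
  split_ifs
  · rw [mul_comm, div_mul_div_cancel]
  · rfl

lemma translate_separation (c : Bool) (g : G) (x y : V) :
    translate K₀ V (incl K₀ c g) (separation K₀ T c x y) =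
      separation K₀ T c (g • x) (g • y) := by
  funext c' e a b
  have h : (incl K₀ c g)⁻¹ * e = incl K₀ c (retract K₀ ((incl K₀ c g)⁻¹ * e)) ↔
      e = incl K₀ c (retract K₀ e) := by
    rw [map_mul, map_inv, retract_incl, map_mul, map_inv, mul_right_inj]
  classical
  refine if_congr (and_congr_right fun _ => h) ?_ rfl
  simp [mul_smul]

/-- The glued graph carries an edge-function-valued potential whose differences are the separation
functions. It is obtained from a crossed homomorphism on the double. -/
lemma exists_potential (hp : ∀ (K : S), ∀ k ∈ (K : Subgroup G), k • p K = p K) :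
    ∃ β : GlueVertex K₀ p → EdgeFunction K₀ V, ∀ c d x y,
      β (mk p c d y) = β (mk p c d x) * translate K₀ V d (separation K₀ T c x y) := by
  set φ := translate K₀ V with hφ
  let B := separation K₀ T
  let x₀ := p K₀
  -- the two summands correspond to a path from `x₀` to its translate by the letter of `K`, which
  -- passes through the copies of `p K`
  obtain ⟨Δ, h1, h2, h3⟩ := exists_crossedHom φ (fun c g => B c x₀ (g • x₀))
    (by
      intro c g h
      rw [hφ, translate_separation, separation_mul, mul_smul])
    (fun K => B true x₀ (p K) * φ (letter K₀ K) (B false (p K) x₀))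
    (by
      change B true x₀ x₀ * φ (letter K₀ K₀) (B false x₀ x₀) = 1
      simp only [B, separation_self, map_one, mul_one])
    (by
      intro K k hk
      have e1 : φ (letter K₀ K) (B false (p K) x₀) * φ (letter K₀ K) (B false x₀ (k • x₀)) =
          φ (incl K₀ true k) (φ (letter K₀ K) (B false (p K) x₀)) := by
        rw [← map_mul, separation_mul, ← MulAut.mul_apply, ← map_mul, ← letter_mul_incl K₀ K hk,
          map_mul, MulAut.mul_apply, hφ, translate_separation, hp K k hk]
      have e2 : B true x₀ (p K) =
          B true x₀ (k • x₀) * φ (incl K₀ true k) (B true x₀ (p K)) := by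
        rw [hφ, translate_separation, hp K k hk, separation_mul]
      rw [mul_assoc, e1, map_mul, ← mul_assoc, ← e2])
  refine ⟨Quot.lift (fun z => Δ z.2.1 * φ z.2.1 (B z.1 x₀ z.2.2)) ?_, ?_⟩
  · rintro _ _ (⟨c, d, g, x⟩ | ⟨d, K⟩)
    · change Δ (d * incl K₀ c g) * φ (d * incl K₀ c g) (B c x₀ x) = Δ d * φ d (B c x₀ (g • x))
      rw [h1, h2, map_mul, MulAut.mul_apply, hφ, translate_separation, mul_assoc, ← map_mul,
        separation_mul]
    · change Δ (d * letter K₀ K) * φ (d * letter K₀ K) (B false x₀ (p K)) =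
        Δ d * φ d (B true x₀ (p K))
      rw [h1, h3, map_mul φ, MulAut.mul_apply, mul_assoc, ← map_mul, mul_assoc, ← map_mul,
        separation_mul, separation_self, map_one, mul_one]
  · intro c d x y
    change Δ d * φ d (B c x₀ y) = Δ d * φ d (B c x₀ x) * φ d (B c x y)
    rw [mul_assoc, ← map_mul, separation_mul]

lemma separation_apply_ne_one (c : Bool) (d : Double S K₀) {x y : V} (h : T.Adj x y) :
    translate K₀ V d (separation K₀ T c x y) c d x y ≠ 1 := by
  simp [translate_apply, separation, sideSign, right_notMem_half, left_mem_half h]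

lemma of_separation_apply_ne_one (hT : IsGTree G T) {c c' : Bool} {d e : Double S K₀} {u v x y : V}
    (huv : T.Adj u v) (hxy : T.Adj x y)
    (h : translate K₀ V d (separation K₀ T c u v) c' e x y ≠ 1) :
    c' = c ∧ ∃ g : G, e = d * incl K₀ c g ∧ s(u, v) = s(g • x, g • y) := by
  rw [translate_apply, separation] at h
  split_ifs at h with hc
  · obtain ⟨hc, he⟩ := hc
    refine ⟨hc, _, (inv_mul_eq_iff_eq_mul.1 he), ?_⟩
    rw [ne_eq, div_eq_one] at h
    have := sym2_eq_of_sideSign_ne hT.isTree hxy (hT.smul_adj _ _ _ huv.symm) h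
    have := congrArg (Sym2.map fun z => retract K₀ (d⁻¹ * e) • z) this
    rw [Sym2.map_mk, smul_inv_smul, smul_inv_smul] at this
    exact Sym2.eq_swap.trans this
  · exact absurd rfl h

/-- The edges of the glued graph are the edges of the copies of the tree, without any
identifications except those coming from the actions of the two copies of `G`. -/
lemma eq_of_mk_eq_of_mk_eq (hT : IsGTree G T)
    (hp : ∀ (K : S), ∀ k ∈ (K : Subgroup G), k • p K = p K) {c c' : Bool} {d d' : Double S K₀}
    {x y x' y' : V} (hxy : T.Adj x y) (hxy' : T.Adj x' y') (hx : mk p c d x = mk p c' d' x')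
    (hy : mk p c d y = mk p c' d' y') :
    c = c' ∧ ∃ g : G, d = d' * incl K₀ c' g ∧ s(x', y') = s(g • x, g • y) := by
  obtain ⟨β, hβ⟩ := exists_potential (T := T) hp
  have h := hβ c d x y
  rw [hx, hy, hβ c' d' x' y', mul_right_inj] at h
  have h1 := separation_apply_ne_one (T := T) c d hxy
  rw [← h] at h1
  exact of_separation_apply_ne_one hT hxy' hxy h1

lemma glueGraph_isGTree (hT : IsGTree G T)
    (hp : ∀ (K : S), ∀ k ∈ (K : Subgroup G), k • p K = p K) :
    IsGTree (Double S K₀) (glueGraph K₀ T p) := by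
  obtain ⟨β, hβ⟩ := exists_potential (T := T) hp
  refine ⟨isTree_of_forall_adj_exists (glueGraph_connected hT.isTree.connected) ?_, ?_, ?_⟩
  · rintro _ _ ⟨c, d, x, y, hxy, rfl, rfl⟩
    refine ⟨ℤˣ, fun z => β z c d x y, ?_, ?_⟩
    · intro h
      dsimp only at h
      rw [hβ c d x y] at h
      exact separation_apply_ne_one c d hxy (left_eq_mul.1 h)
    · rintro _ _ ⟨c', d', u, v, huv, rfl, rfl⟩ h
      obtain ⟨rfl, g, rfl, hg⟩ := of_separation_apply_ne_one (c := c') (c' := c) (d := d')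
        (e := d) hT huv hxy (fun h1 => h (by
          change β (mk p c' d' u) c d x y = β (mk p c' d' v) c d x y
          rw [hβ c' d' u v]
          change _ = β (mk p c' d' u) c d x y * _
          rw [h1, mul_one]))
      rw [mk_mul_incl, mk_mul_incl]
      exact congrArg (Sym2.map fun z => mk p c d' z) hg
  · rintro e _ _ ⟨c, d, x, y, h, rfl, rfl⟩
    exact glueGraph_adj c (e * d) h
  · rintro e _ _ ⟨c, d, x, y, h, rfl, rfl⟩ ⟨h1, h2⟩
    refine hT.no_inversion (retract K₀ e) _ _ (hT.smul_adj (retract K₀ d) _ _ h) ⟨?_, ?_⟩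
    · simpa [proj_smul, proj_mk] using congrArg proj h1
    · simpa [proj_smul, proj_mk] using congrArg proj h2

lemma glueGraph_hasFiniteEdgeStabilizers (hT : IsGTree G T) (hf : HasFiniteEdgeStabilizers G T)
    (hp : ∀ (K : S), ∀ k ∈ (K : Subgroup G), k • p K = p K) :
    HasFiniteEdgeStabilizers (Double S K₀) (glueGraph K₀ T p) := by
  rintro _ _ ⟨c, d, x, y, hxy, rfl, rfl⟩
  have hfin : ((edgeStabilizer G x y : Subgroup G) : Set G).Finite :=
    have := hf x y hxy
    Set.toFinite _
  refine Set.Finite.subset (hfin.image fun g => d * (incl K₀ c g)⁻¹ * d⁻¹) ?_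
  rintro e ⟨h1, h2⟩
  obtain ⟨-, g, hg, hs⟩ := eq_of_mk_eq_of_mk_eq hT hp (c := c) (c' := c) (d := d) (d' := e * d)
    hxy hxy h1.symm h2.symm
  refine ⟨g, hT.smul_eq_of_sym2_eq hxy hs.symm, ?_⟩
  dsimp only
  nth_rewrite 1 [hg]
  group

/-- A splitting of `G` relative to the subgroups in `S` induces a splitting of the double. -/
theorem SplitsOverFiniteRel.double (K₀ : S) (h : SplitsOverFiniteRel G S) :
    SplitsOverFiniteRel (Double S K₀) ∅ := by
  obtain ⟨V, _, T, hT, hf, hfix, hell⟩ := h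
  choose p hp using fun K : S => hell K K.2
  have hp' : ∀ (K : S), ∀ k ∈ (K : Subgroup G), k • p K = p K := fun K k hk => hp K hk
  refine ⟨GlueVertex K₀ p, inferInstance, glueGraph K₀ T p, glueGraph_isGTree hT hp',
    glueGraph_hasFiniteEdgeStabilizers hT hf hp', fun z hz => ?_, fun K hK => hK.elim⟩
  refine hfix (proj z) (eq_top_iff.2 fun g _ => ?_)
  have h1 : incl K₀ false g ∈ MulAction.stabilizer (Double S K₀) z := hz ▸ Subgroup.mem_top _
  have h2 := congrArg proj (MulAction.mem_stabilizer_iff.1 h1)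
  rwa [proj_smul, retract_incl] at h2

end Glue

/-! ### The Bass-Serre tree of the double -/

open GlueVertex

section BassSerre

variable {G : Type u} [Group G] {S : Set (Subgroup G)}

variable (S) in
/-- The vertices of a star with one leaf for each coset of a member of `S`; its centre is `none`. -/
abbrev StarVertex : Type u := Option (Σ K : S, G ⧸ (K : Subgroup G))

variable (S) in
/-- The star with one leaf for each coset of a member of `S`. The tree for the double glued from its
copies along `starLeaf` is the barycentric subdivision of the Bass-Serre tree of the double. -/
def starGraph : SimpleGraph (StarVertex S) where
  Adj x y := (x = none ∧ y ≠ none) ∨ (y = none ∧ x ≠ none)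
  symm := ⟨fun _ _ h => h.symm⟩
  loopless := ⟨by
    rintro x (⟨h, h'⟩ | ⟨h, h'⟩) <;> exact h' h⟩

/-- The leaf of the star which is the trivial coset of `K`. -/
def starLeaf (K : S) : StarVertex S := some ⟨K, ((1 : G) : G ⧸ (K : Subgroup G))⟩

lemma starGraph_isGTree : IsGTree G (starGraph S) := by
  have hadj : ∀ q, (starGraph S).Adj none (some q) := fun q => Or.inl ⟨rfl, Option.some_ne_none q⟩
  refine ⟨isTree_of_forall_adj_exists ?_ ?_, ?_, ?_⟩
  · have h : ∀ x, (starGraph S).Reachable none x := by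
      rintro (_ | q)
      · exact SimpleGraph.Reachable.refl _
      · exact (hadj q).reachable
    exact ⟨fun x y => (h x).symm.trans (h y)⟩
  · have key : ∀ q x y, (starGraph S).Adj x y → (x = some q) ≠ (y = some q) →
        s(x, y) = s(none, some q) := by
      rintro q x y (⟨rfl, hy⟩ | ⟨rfl, hx⟩) hne
      · by_cases h : y = some q
        · rw [h]
        · simp [h] at hne
      · by_cases h : x = some q
        · rw [h]
          exact Sym2.eq_swap
        · simp [h] at hne
    rintro x y (⟨rfl, hy⟩ | ⟨rfl, hx⟩)
    · obtain ⟨q, rfl⟩ := Option.ne_none_iff_exists'.1 hy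
      exact ⟨Prop, fun z => z = some q, by simp, key q⟩
    · obtain ⟨q, rfl⟩ := Option.ne_none_iff_exists'.1 hx
      refine ⟨Prop, fun z => z = some q, by simp, fun x y h h' => ?_⟩
      rw [key q x y h h']
      exact Sym2.eq_swap
  · rintro g (_ | q) (_ | r) (⟨h, h'⟩ | ⟨h, h'⟩)
    all_goals first | exact absurd rfl h' | exact absurd h (Option.some_ne_none _) | skip
    · exact Or.inl ⟨rfl, Option.some_ne_none _⟩
    · exact Or.inr ⟨rfl, Option.some_ne_none _⟩
  · rintro g _ _ (⟨rfl, h⟩ | ⟨rfl, h⟩) ⟨h1, h2⟩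
    · exact h h1.symm
    · exact h h2.symm

lemma smul_starLeaf (g : G) (K : S) :
    g • starLeaf K = some ⟨K, (g : G ⧸ (K : Subgroup G))⟩ :=
  congrArg (fun h : G => (some ⟨K, (h : G ⧸ (K : Subgroup G))⟩ : StarVertex S)) (mul_one g)

lemma eq_of_smul_starLeaf_eq {g : G} {K L : S} (h : g • starLeaf K = starLeaf L) :
    K = L ∧ g ∈ (L : Subgroup G) := by
  rw [smul_starLeaf, starLeaf, Option.some_inj, Sigma.mk.injEq] at h
  obtain ⟨rfl, h⟩ := h
  refine ⟨rfl, ?_⟩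
  have := QuotientGroup.eq.1 (eq_of_heq h).symm
  simpa using this

lemma smul_starLeaf_of_mem {g : G} {K : S} (hg : g ∈ (K : Subgroup G)) :
    g • starLeaf K = starLeaf K := by
  rw [smul_starLeaf, starLeaf, Option.some_inj, Sigma.mk.injEq]
  exact ⟨rfl, heq_of_eq (QuotientGroup.eq.2 (by simpa using hg))⟩

variable {K₀ : S}

/-- Consider a finite non-empty set of edges of the Bass-Serre tree of the double. Then some
vertex of that tree lies on exactly one of them. Here `C c K d` says that the translate by `d` of
the edge labelled `K` at the `c`-th base vertex belongs to the set. -/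
lemma exists_unique_edge (C : Bool → S → Double S K₀ → Prop)
    (hC : ∀ K d, C true K d ↔ C false K (d * letter K₀ K))
    (hfin : {z : GlueVertex K₀ (starLeaf (S := S)) |
      ∃ K d, C false K d ∧ z = mk starLeaf false d (starLeaf K)}.Finite)
    (hne : ∃ K d, C false K d) :
    ∃ c d K, C c K d ∧ ∀ L g, C c L (d * incl K₀ c g) → L = K ∧ g ∈ (K : Subgroup G) := by
  have hp : ∀ (K : S), ∀ k ∈ (K : Subgroup G), k • starLeaf K = starLeaf K :=
    fun K k hk => smul_starLeaf_of_mem hk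
  set Z := glueGraph K₀ (starGraph S) starLeaf with hZ_def
  have hZ : Z.IsTree := (glueGraph_isGTree starGraph_isGTree hp).isTree
  obtain ⟨z₀⟩ := hZ.connected.nonempty
  obtain ⟨K, d, hKd⟩ := hne
  -- an edge (a leaf vertex of a star) in the set at maximal distance from the base point
  obtain ⟨m, ⟨K, d, hKd, hm⟩, hmax⟩ := Set.exists_max_image _ (fun z => Z.dist z₀ z) hfin
    ⟨_, K, d, hKd, rfl⟩
  have hadj : ∀ c (d : Double S K₀) (g : G) K,
      Z.Adj (mk starLeaf c d none) (mk starLeaf c d (g • starLeaf K)) :=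
    fun c d g K =>
      glueGraph_adj c d (Or.inl ⟨rfl, by rw [smul_starLeaf]; exact Option.some_ne_none _⟩)
  have hadj1 : ∀ c (d : Double S K₀) K,
      Z.Adj (mk starLeaf c d none) (mk starLeaf c d (starLeaf K)) := by
    intro c d K
    simpa using hadj c d 1 K
  have hm' : m = mk starLeaf true (d * (letter K₀ K)⁻¹) (starLeaf K) := by
    rw [hm, ← mk_mul_letter, inv_mul_cancel_right]
  have hmem : ∀ c L e, C c L e → Z.dist z₀ (mk starLeaf c e (starLeaf L)) ≤ Z.dist z₀ m := by
    rintro (_ | _) L e h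
    · exact hmax _ ⟨L, e, h, rfl⟩
    · exact hmax _ ⟨L, e * letter K₀ L, (hC L e).1 h, (mk_mul_letter _ _).symm⟩
  obtain ⟨c, e, he, hme, hz⟩ : ∃ c e, C c K e ∧ m = mk starLeaf c e (starLeaf K) ∧
      z₀ ∉ half Z (mk starLeaf c e none) m := by
    by_contra! h
    have h1 := h false d hKd hm
    have h2 := h true (d * (letter K₀ K)⁻¹) ((hC _ _).2 (by rwa [inv_mul_cancel_right])) hm'
    have h3 := eq_of_mem_half_of_mem_half hZ (hm ▸ hadj1 false d K) (hm' ▸ hadj1 true _ K) h1 h2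
    have h4 := eq_of_mk_eq_of_mk_eq starGraph_isGTree hp (x := none) (x' := none)
      (Or.inl ⟨rfl, Option.some_ne_none _⟩) (Or.inl ⟨rfl, Option.some_ne_none _⟩)
      h3 (hm.symm.trans hm')
    exact Bool.false_ne_true h4.1
  have hadjm : Z.Adj (mk starLeaf c e none) m := hme ▸ hadj1 c e K
  rw [notMem_half_iff hZ hadjm] at hz
  refine ⟨c, e, K, he, fun L g hL => ?_⟩
  have hd := hmem c L _ hL
  rw [mk_mul_incl] at hd
  have hmm : mk starLeaf c e (g • starLeaf L) = m := by
    by_contra hne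
    have hz' : z₀ ∉ half Z (mk starLeaf c e (g • starLeaf L)) (mk starLeaf c e none) :=
      fun h => hne (eq_of_mem_half_of_mem_half hZ (hadj c e g L).symm hadjm.symm h hz)
    rw [notMem_half_iff hZ (hadj c e g L).symm] at hz'
    simp only [half, Set.mem_ofPred_eq] at hz hz'
    omega
  have := congrArg proj (hmm.trans hme)
  rw [proj_mk, proj_mk, smul_left_cancel_iff] at this
  exact eq_of_smul_starLeaf_eq this

end BassSerre

/-! ### Restricting actions along homomorphisms -/

section CompHom

variable {G D : Type u} [Group G] [Group D] {V : Type u} [MulAction D V] {T : SimpleGraph V}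
  (f : G →* D)

lemma IsGTree.compHom (hT : IsGTree D T) :
    letI := MulAction.compHom V f
    IsGTree G T :=
  letI := MulAction.compHom V f
  ⟨hT.isTree, fun g => hT.smul_adj (f g), fun g => hT.no_inversion (f g)⟩

variable {f}

lemma HasFiniteEdgeStabilizers.compHom (hf : HasFiniteEdgeStabilizers D T)
    (hinj : Function.Injective f) :
    letI := MulAction.compHom V f
    HasFiniteEdgeStabilizers G T := by
  let _ := MulAction.compHom V f
  intro x y hxy
  have := hf x y hxy
  exact Finite.of_injective
    (fun g : edgeStabilizer G x y => (⟨f g, g.2⟩ : edgeStabilizer D x y))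
    fun g h e => Subtype.ext (hinj (congrArg Subtype.val e))

lemma isDeep_compHom_iff (hinj : Function.Injective f) {K : Subgroup G} {a b : V} :
    (letI := MulAction.compHom V f
     IsDeep T K a b) ↔ IsDeep T (K.map f) a b := by
  let _ := MulAction.compHom V f
  refine forall_congr' fun y => ?_
  rw [← Set.infinite_image_iff (f := f) hinj.injOn]
  refine iff_of_eq (congrArg Set.Infinite ?_)
  ext d
  constructor
  · rintro ⟨k, ⟨hk, h⟩, rfl⟩
    exact ⟨⟨k, hk, rfl⟩, h⟩
  · rintro ⟨⟨k, hk, rfl⟩, h⟩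
    exact ⟨k, ⟨hk, h⟩, rfl⟩

lemma crosses_compHom_iff (hinj : Function.Injective f) {K : Subgroup G} {a b : V} :
    (letI := MulAction.compHom V f
     Crosses T K a b) ↔ Crosses T (K.map f) a b :=
  and_congr (isDeep_compHom_iff hinj) (isDeep_compHom_iff hinj)

end CompHom

/-! ### Fixed points of the double -/

section FixedPoints

variable {G : Type u} [Group G]

lemma AreConj.symm {K L : Subgroup G} (h : AreConj K L) : AreConj L K := by
  obtain ⟨g, rfl⟩ := h
  refine ⟨g⁻¹, ?_⟩
  rw [Subgroup.map_map]
  ext k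
  constructor
  · intro hk
    exact ⟨k, hk, by simp [mul_assoc]⟩
  · rintro ⟨k, hk, rfl⟩
    simpa [mul_assoc] using hk

lemma AreConj.trans {K L M : Subgroup G} (h : AreConj K L) (h' : AreConj L M) : AreConj K M := by
  obtain ⟨g, rfl⟩ := h
  obtain ⟨g', rfl⟩ := h'
  refine ⟨g' * g, ?_⟩
  rw [Subgroup.map_map, map_mul]
  rfl

lemma IsConjTransversal.finite {S 𝓗 : Set (Subgroup G)} (hS : IsConjTransversal S 𝓗)
    (h𝓗 : IsFiniteUnionOfConjClasses 𝓗) : S.Finite := by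
  obtain ⟨F, hF, rfl⟩ := h𝓗
  have h : ∀ H : Subgroup G, ∃ K, H ∈ S → K ∈ F ∧ AreConj K H := by
    intro H
    by_cases hH : H ∈ S
    · obtain ⟨K, hK, hKH⟩ := hS.1 hH
      exact ⟨K, fun _ => ⟨hK, hKH⟩⟩
    · exact ⟨H, fun h => absurd h hH⟩
  choose f hf using h
  refine Set.Finite.of_finite_image (f := f) (hF.subset ?_) ?_
  · rintro _ ⟨H, hH, rfl⟩
    exact (hf H hH).1
  · intro H hH H' hH' e
    have hc : AreConj H' H := (hf H' hH').2.symm.trans (e ▸ (hf H hH).2)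
    exact (hS.2 H (hS.1 hH)).unique ⟨hH, 1, by ext; simp⟩ ⟨hH', hc⟩

lemma eq_of_infinite_le_stabilizer {V : Type u} [MulAction G V] {T : SimpleGraph V}
    (hT : IsGTree G T) (hf : HasFiniteEdgeStabilizers G T) {K : Subgroup G}
    (hK : (K : Set G).Infinite) {x y : V} (hx : K ≤ MulAction.stabilizer G x)
    (hy : K ≤ MulAction.stabilizer G y) : x = y := by
  by_contra hne
  obtain ⟨z, hxz, hle⟩ := hT.exists_le_edgeStabilizer hne
  have := hf x z hxz
  exact hK ((Set.toFinite (edgeStabilizer G x z : Set G)).subset ((le_inf hx hy).trans hle))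

variable {𝓗 S : Set (Subgroup G)} {K₀ : S} {V : Type u} [MulAction (Double S K₀) V]
  {T : SimpleGraph V}

/-- If the members of `𝓗`, embedded into one of the two copies of `G`, are elliptic in a tree for
the double with finite edge stabilisers and `𝓗` is indecomposable, then this copy of `G` is
elliptic. -/
lemma exists_forall_incl_smul_eq (hT : IsGTree (Double S K₀) T)
    (hf : HasFiniteEdgeStabilizers (Double S K₀) T) (h𝓗 : IsIndecomposable 𝓗)
    (hS : IsConjTransversal S 𝓗) (c : Bool)
    (hell : ∀ K : S, ∃ v : V, (K : Subgroup G).map (incl K₀ c) ≤ MulAction.stabilizer _ v) :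
    ∃ v : V, ∀ g, incl K₀ c g • v = v := by
  by_contra! hfix
  let _ := MulAction.compHom V (incl K₀ c)
  refine h𝓗 ⟨V, inferInstance, T, hT.compHom (incl K₀ c), hf.compHom (incl_injective c), ?_, ?_⟩
  · intro v hv
    obtain ⟨g, hg⟩ := hfix v
    have : g ∈ MulAction.stabilizer G v := hv ▸ Subgroup.mem_top g
    exact hg this
  · intro L hL
    obtain ⟨K, ⟨hK, g, rfl⟩, -⟩ := hS.2 L hL
    obtain ⟨v, hv⟩ := hell ⟨K, hK⟩
    refine ⟨g • v, ?_⟩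
    rintro _ ⟨k, hk, rfl⟩
    have hkv : k • v = v := hv ⟨k, hk, rfl⟩
    change (g * k * g⁻¹) • g • v = g • v
    rw [← mul_smul, inv_mul_cancel_right, mul_smul, hkv]

/-- If `𝓗` is indecomposable and no member of `𝓗` crosses an edge of a tree for the double with
finite edge stabilisers, then the double fixes a vertex. -/
lemma exists_stabilizer_eq_top (hT : IsGTree (Double S K₀) T)
    (hf : HasFiniteEdgeStabilizers (Double S K₀) T) (h𝓗 : IsIndecomposable 𝓗)
    (h2 : ∀ K ∈ 𝓗, IsTwoEnded K) (hS : IsConjTransversal S 𝓗)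
    (hcr : ∀ (K : S) (u v : V), T.Adj u v →
      ¬ Crosses T ((K : Subgroup G).map (incl K₀ false)) u v) :
    ∃ v : V, MulAction.stabilizer (Double S K₀) v = ⊤ := by
  choose t ht using fun K : S => (h2 K (hS.1 K.2)).exists_isVirtuallyZPowers
  have hinf : ∀ (K : S) c, ((K : Subgroup G).map (incl K₀ c) : Set (Double S K₀)).Infinite :=
    fun K c => ((ht K).map (incl_injective c)).infinite
  have hell := fun K : S => exists_le_stabilizer_of_forall_not_crosses hT hf
    ((ht K).map (incl_injective (K₀ := K₀) false)) (hcr K)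
  obtain ⟨v, hv⟩ := exists_forall_incl_smul_eq hT hf h𝓗 hS false hell
  -- the letter of `K` moves a fixed point of one copy of `K` to a fixed point of the other
  have hletter : ∀ K : S,
      (K : Subgroup G).map (incl K₀ true) ≤ MulAction.stabilizer _ (letter K₀ K • v) := by
    rintro K _ ⟨k, hk, rfl⟩
    change incl K₀ true k • letter K₀ K • v = letter K₀ K • v
    rw [← mul_smul, ← letter_mul_incl K₀ K hk, mul_smul, hv]
  obtain ⟨w, hw⟩ := exists_forall_incl_smul_eq hT hf h𝓗 hS true fun K => ⟨_, hletter K⟩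
  have hlw : ∀ K : S, letter K₀ K • v = w := by
    intro K
    refine eq_of_infinite_le_stabilizer hT hf (hinf K true) (hletter K) ?_
    rintro _ ⟨k, -, rfl⟩
    exact hw k
  have hvw : v = w := by rw [← hlw K₀, letter_base, one_smul]
  subst hvw
  refine ⟨v, subgroup_eq_top ?_ hlw⟩
  rintro (_ | _) g
  exacts [hv g, hw g]

end FixedPoints

end DoubleOfGroup

open DoubleOfGroup Double GlueVertex in
/-- `S` is any set of representatives of the conjugacy classes in `𝓗`, and `K₀` any of them. The
hypothesis `𝓗 ≠ {⊤}` says that the two vertices of the graph of groups are not trivial vertices. -/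
theorem corollary2p4 {G : Type u} [Group G] (𝓗 : Set (Subgroup G))
    (h𝓗 : DoubleOfGroup.IsFiniteUnionOfConjClasses 𝓗)
    (h_two : ∀ K ∈ 𝓗, DoubleOfGroup.IsTwoEnded K)
    (h_nontriv : 𝓗 ≠ {⊤})
    (S : Set (Subgroup G)) (hS : DoubleOfGroup.IsConjTransversal S 𝓗) (K₀ : S) :
    DoubleOfGroup.IsIndecomposable 𝓗 ↔
      DoubleOfGroup.IsOneEnded (DoubleOfGroup.Double S K₀) := by
  have hSfin : Finite S := (hS.finite h𝓗).to_subtype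
  choose t ht using fun K : S => (h_two K (hS.1 K.2)).exists_isVirtuallyZPowers
  constructor
  · intro hind
    refine ⟨?_, ?_⟩
    · have := ((ht K₀).map (incl_injective (K₀ := K₀) false)).infinite
      exact Set.infinite_univ_iff.1 (this.mono (Set.subset_univ _))
    rintro ⟨V, _, T, hT, hf, hfix, -⟩
    replace hf : HasFiniteEdgeStabilizers (Double S K₀) T := hf
    by_cases hcr : ∀ (K : S) (u v : V), T.Adj u v →
        ¬ Crosses T ((K : Subgroup G).map (incl K₀ false)) u v
    · obtain ⟨v, hv⟩ := exists_stabilizer_eq_top hT hf hind h_two hS hcr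
      exact hfix v hv
    push Not at hcr
    obtain ⟨K₁, a, b, hab, hcr⟩ := hcr
    have hW := fun K : S =>
      exists_finite_of_crosses hT hf ((ht K).map (incl_injective (K₀ := K₀) false)) hab
    choose W hWfin hW using hW
    obtain ⟨c, d, K, hK, huniq⟩ := exists_unique_edge (K₀ := K₀)
      (fun c K d => Crosses T ((K : Subgroup G).map (incl K₀ c)) (d⁻¹ • a) (d⁻¹ • b))
      (by
        intro K d
        rw [map_incl_true, crosses_map_conj hT, mul_inv_rev, mul_smul, mul_smul])
      (by
        refine (Set.finite_iUnion fun K => (hWfin K).image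
          fun d => mk starLeaf false d (starLeaf K)).subset ?_
        rintro _ ⟨K, d, h, rfl⟩
        obtain ⟨_, ⟨k, hk, rfl⟩, hkW⟩ := hW K d h
        refine Set.mem_iUnion.2 ⟨K, _, hkW, ?_⟩
        dsimp only
        rw [mk_mul_incl, smul_starLeaf_of_mem hk])
      ⟨K₁, 1, by simpa using hcr⟩
    let _ := MulAction.compHom V (incl K₀ c)
    refine hind (splitsOverFiniteRel_of_unique_crosses (hT.compHom (incl K₀ c))
      (hf.compHom (incl_injective c)) (fun H hH => (h_two H hH).exists_isVirtuallyZPowers) hS.1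
      (fun L hL => (hS.2 L hL).exists) K.2 h_nontriv (hT.smul_adj d⁻¹ _ _ hab)
      ((crosses_compHom_iff (incl_injective c)).2 hK) ?_)
    intro H hH g hg
    have := (crosses_compHom_iff (incl_injective c)).1 hg
    obtain ⟨h1, h2⟩ := huniq ⟨H, hH⟩ g (by
      rw [mul_inv_rev, mul_smul, mul_smul, ← map_inv]
      exact this)
    exact ⟨congrArg Subtype.val h1, h2⟩
  · rintro ⟨-, h⟩ ⟨V, _, T, hT, hf, hfix, hell⟩
    exact h (SplitsOverFiniteRel.double K₀ ⟨V, _, T, hT, hf, hfix, fun K hK => hell K (hS.1 hK)⟩)
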